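/- Let $\mathcal X,\Theta$ be real Banach spaces with their Borel $\sigma$-algebras, $\nu$ and $\mu$ probability measures on $\mathcal X$ and $\Theta$, $\mathcal Y$ a real separable Hilbert space, $F^\dagger\in L^\infty_\nu(\mathcal X;\mathcal Y)$, and $\varphi\in L^\infty_{\nu\times\mu}(\mathcal X\times\Theta;\mathcal Y)$ a random feature map. Let $$k_\mu(a,a')=\mathbb E^{\theta\sim\mu}\bigl[\varphi(a;\theta)\otimes\varphi(a';\theta)\bigr]\in\mathcal L(\mathcal Y),\qquad (u\otimes v)c=\langle v,c\rangle_{\mathcal Y}\,u,$$ and assume that the $\mathcal Y$-valued reproducing kernel Hilbert space (RKHS) with kernel $k_\mu$ is separable and that the integral operator $T_{k_\mu}F=\mathbb E^{a'\sim\nu}[k_\mu(\cdot,a')F(a')]$ is injective on $L^2_\nu(\mathcal X;\mathcal Y)$. It is not assumed that $F^\dagger$ lies in the RKHS. Let $\{\delta_l\}_{l\in\mathbb N}\subset(0,1)$ satisfy $\sum_l\delta_l<\infty$, and let $m_l,n_l\in\mathbb N$ and $\lambda_l\in\mathbb R$ satisfy $$m_l\simeq\delta_l^{-1}\log(2/\delta_l),\qquad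 n_l\simeq\delta_l^{-2}\log(2/\delta_l),\qquad \lambda_l\simeq m_l,$$ where $f_l\simeq g_l$ means that $c\,g_l\le f_l\le C\,g_l$ for all $l$ with constants $c,C>0$ independent of $l$. On a probability space $(\Omega,\mathbb P)$ let, for each $l$, the inputs $a^{(l)}_1,\dots,a^{(l)}_{n_l}\sim\nu$ and the feature parameters $\theta^{(l)}_1,\dots,\theta^{(l)}_{m_l}\sim\mu$ be jointly independent (with arbitrary dependence between different $l$; for instance, they may be the initial segments of two infinite sequences). Put $F_{m_l}(a;\alpha)=\frac1{m_l}\sum_{j=1}^{m_l}\alpha_j\varphi(a;\theta^{(l)}_j)$ and let $\widehat\alpha^{(l)}\in\mathbb R^{m_l}$ be the minimizer of $$\alpha\mapsto\sum_{i=1}^{n_l}\tfrac12\bigl\|F^\dagger(a^{(l)}_i)-F_{m_l}(a^{(l)}_i;\alpha)\bigr\|_{\mathcal Y}^2+\frac{\lambda_l}{2m_l}\|\alpha\|_2^2 .$$ Then, $\mathbb P$-almost surely, $F^\dagger-F_{m_l}(\cdot\,;\widehat\alpha^{(l)})\in L^2_\nu(\mathcal X;\mathcal Y)$ for all $l$ and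 $$\lim_{l\to\infty}\mathbb E^{a\sim\nu}\bigl\|F^\dagger(a)-F_{m_l}(a;\widehat\alpha^{(l)})\bigr\|_{\mathcal Y}^2=0 .$$ -/

import Mathlib

open MeasureTheory ProbabilityTheory Filter Topology

noncomputable section

namespace RandomFeatures

/-- The operator-valued kernel `k_μ(a, a') = E^{θ ∼ μ} [φ(a; θ) ⊗ φ(a'; θ)] ∈ 𝓛(Y)` of a random
feature pair `(φ, μ)`, a Bochner integral in the space of bounded operators on `Y`.
Here `InnerProductSpace.rankOne ℝ u v` is the outer product `u ⊗ v : c ↦ ⟪v, c⟫ u`. -/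
def featureKernel {X T Y : Type*} [MeasurableSpace T] [NormedAddCommGroup Y]
    [InnerProductSpace ℝ Y] (φ : X → T → Y) (μ : Measure T) (a a' : X) : Y →L[ℝ] Y :=
  ∫ θ, InnerProductSpace.rankOne ℝ (φ a θ) (φ a' θ) ∂μ

/-- The kernel integral operator `(T_k F)(a) = E^{a' ∼ ν} [k(a, a') F(a')]`. -/
def kernelIntegral {X Y : Type*} [MeasurableSpace X] [NormedAddCommGroup Y]
    [InnerProductSpace ℝ Y] (k : X → X → Y →L[ℝ] Y) (ν : Measure X) (F : X → Y) (a : X) : Y :=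
  ∫ a', k a a' (F a') ∂ν

/-- `T_k`, as a map on `L²_ν(X; Y)` (whose elements are classes of `ν`-a.e. equal maps),
is injective. -/
def KernelIntegralInjective {X Y : Type*} [MeasurableSpace X] [NormedAddCommGroup Y]
    [InnerProductSpace ℝ Y] (k : X → X → Y →L[ℝ] Y) (ν : Measure X) : Prop :=
  ∀ F G : Lp Y 2 ν, kernelIntegral k ν F =ᵐ[ν] kernelIntegral k ν G → F = G

/-- `H` is the reproducing kernel Hilbert space of the random feature pair `(φ, μ)`: its
reproducing kernel is `k_μ`. The kernel is prescribed at all pairs of inputs whose features are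
square integrable, that is, where `k_μ` is defined; for a bounded measurable `φ` these are
all pairs. -/
def IsFeatureRKHS {X T Y : Type*} [MeasurableSpace T] [NormedAddCommGroup Y]
    [InnerProductSpace ℝ Y] [CompleteSpace Y] (φ : X → T → Y) (μ : Measure T)
    (H : Type*) [NormedAddCommGroup H] [InnerProductSpace ℝ H] [CompleteSpace H]
    [RKHS ℝ H X Y] : Prop :=
  ∀ a a' : X, MemLp (φ a) 2 μ → MemLp (φ a') 2 μ →
    RKHS.kernel H a a' = featureKernel φ μ a a'

/-- The random feature model `F_m(a; α) = (1/m) ∑_j α_j φ(a; θ_j)`. -/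
def rfm {X T Y : Type*} [NormedAddCommGroup Y] [InnerProductSpace ℝ Y] (φ : X → T → Y)
    {m : ℕ} (θ : Fin m → T) (α : EuclideanSpace ℝ (Fin m)) (a : X) : Y :=
  (1 / (m : ℝ)) • ∑ j, α j • φ a (θ j)

/-- The random feature ridge regression objective
`∑_i ½ ‖y_i - F_m(a_i; α)‖² + λ/(2m) ‖α‖₂²`. -/
def ridgeObjective {X T Y : Type*} [NormedAddCommGroup Y] [InnerProductSpace ℝ Y]
    (φ : X → T → Y) {m n : ℕ} (θ : Fin m → T) (a : Fin n → X) (y : Fin n → Y) (reg : ℝ)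
    (α : EuclideanSpace ℝ (Fin m)) : ℝ :=
  (∑ i, (1 / 2 : ℝ) * ‖y i - rfm φ θ α (a i)‖ ^ 2) + reg / (2 * (m : ℝ)) * ‖α‖ ^ 2

/-- `α` are trained coefficients: a global minimizer of the ridge regression objective
(it is unique when the regularization parameter is positive). -/
def IsTrained {X T Y : Type*} [NormedAddCommGroup Y] [InnerProductSpace ℝ Y]
    (φ : X → T → Y) {m n : ℕ} (θ : Fin m → T) (a : Fin n → X) (y : Fin n → Y) (reg : ℝ)
    (α : EuclideanSpace ℝ (Fin m)) : Prop :=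
  IsMinOn (ridgeObjective φ θ a y reg) Set.univ α

/-- `f ≃ g`: the sequences agree up to positive multiplicative constants. -/
def TwoSidedBound (f g : ℕ → ℝ) : Prop :=
  ∃ c C : ℝ, 0 < c ∧ 0 < C ∧ ∀ l, c * g l ≤ f l ∧ f l ≤ C * g l

end RandomFeatures

end

/-!
The proof compares the trained model with explicit competitors. The reason for convergence is a
balance between three facts.

*Approximation.* For bounded `h : T → ℝ` put `A h = E^{θ ∼ μ} [h(θ) φ(·; θ)]` (`featureAverage`).
A function `g ∈ L²_ν(X; Y)` orthogonal to every `A h` is in particular orthogonal to `A h` for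
`h(θ) = E^ν ⟪φ(·; θ), g⟫`. This says `E^μ h² = 0`, so that `T_k g = A h = 0` and, by injectivity,
`g = 0`. Hence the functions `A h` are dense in `L²_ν(X; Y)`
(`featureAverageSubmodule_topologicalClosure`), and no element of the RKHS has to be close to the
target in any stronger sense.

*Concentration.* The residual `F - F_m(·; α)` is linear in the coefficients `(1, -α/√m)`, so the
difference between its population and its empirical risk is a quadratic form. Its matrix is the
deviation of an empirical Gram matrix of a family whose squared norms have a bounded sum. By a
Hoeffding inequality in Hilbert space, applied in the Frobenius norm, this matrix is of order `δ`
with probability at least `1 - δ`, because `n δ²` is of order `log (2/δ)`. (Chebyshev's inequality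
would bound the failure probability only by a multiple of `1 / log (2/δ)`.) Thus the gap is at most
of order `δ (1 + ‖α‖²/m)`, uniformly in `α`. The Hoeffding inequality is Pinelis' argument:
`cosh ‖·‖` of a sum of independent centred vectors grows in mean at most by the factor `exp (S²)`
with each summand of norm at most `S` (`cosh_norm_add_le`), which rests on the convexity of `u ↦
cosh √u`.

*Regularization.* The penalty contributes `(λ/n) ‖α‖²/m` to the mean objective and `λ/n` is of order
`δ`, so it absorbs the part of the gap that grows with `α`, while it costs only `O(δ)` for the
competitor `α_j = h(θ_j)` (`IsTrained.popRisk_le`).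

Together, with probability at least `1 - 3δ`, the population risk of the trained model is at most
`C₀ (2 ‖F - A h‖² + K_h δ)` with `C₀` independent of `h` (`exists_ae_eventually_popRisk_le`). As the
`δ_l` are summable, the Borel-Cantelli lemma makes this hold almost surely for all large `l`,
whatever the dependence between different `l`; letting `l → ∞` and then optimizing over countably
many `h` gives the limit.
-/

namespace RandomFeatures

/-! ### Exponential concentration in Hilbert spaces -/

section Concentration

variable {E : Type*} [NormedAddCommGroup E] [InnerProductSpace ℝ E]

/-- The function `u ↦ cosh √u` is convex because its power series has nonnegative coefficients;
this is its chord inequality between `(a - b)²` and `(a + b)²`, where `c` plays the role of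
`√u`. -/
lemma cosh_le_of_sq_eq {a b t c : ℝ} (ht : |t| ≤ 1) (hc : c ^ 2 = a ^ 2 + 2 * t * (a * b) + b ^ 2) :
    Real.cosh c ≤ Real.cosh a * Real.cosh b + t * (Real.sinh a * Real.sinh b) := by
  obtain ⟨ht1, ht2⟩ := abs_le.mp ht
  have h1 : Real.cosh a * Real.cosh b + t * (Real.sinh a * Real.sinh b)
      = (1 + t) / 2 * Real.cosh (a + b) + (1 - t) / 2 * Real.cosh (a - b) := by
    rw [Real.cosh_add, Real.cosh_sub]; ring
  rw [h1]
  refine hasSum_le (fun k => ?_) (Real.hasSum_cosh c)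
    (((Real.hasSum_cosh (a + b)).mul_left ((1 + t) / 2)).add
      ((Real.hasSum_cosh (a - b)).mul_left ((1 - t) / 2)))
  have h2 := (convexOn_pow (𝕜 := ℝ) k).2 (Set.mem_Ici.mpr (sq_nonneg (a + b)))
    (Set.mem_Ici.mpr (sq_nonneg (a - b))) (show 0 ≤ (1 + t) / 2 by linarith)
    (show 0 ≤ (1 - t) / 2 by linarith) (by ring)
  have h3 : (1 + t) / 2 * (a + b) ^ 2 + (1 - t) / 2 * (a - b) ^ 2 = c ^ 2 := by rw [hc]; ring
  simp only [smul_eq_mul, h3] at h2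
  rw [pow_mul, pow_mul, pow_mul, ← mul_div_assoc, ← mul_div_assoc, ← add_div]
  gcongr

lemma exp_sub_le_exp_sq {b : ℝ} (hb : 0 ≤ b) : Real.exp b - b ≤ Real.exp (b ^ 2) := by
  rcases le_total 1 b with h | h
  · have : Real.exp b ≤ Real.exp (b ^ 2) := Real.exp_le_exp.mpr (by nlinarith)
    linarith
  · have h1 := (abs_le.mp (Real.abs_exp_sub_one_sub_id_le (abs_le.mpr ⟨by linarith, h⟩))).2
    have h2 := Real.add_one_le_exp (b ^ 2)
    linarith

lemma le_sinh_of_nonneg {b : ℝ} (hb : 0 ≤ b) : b ≤ Real.sinh b := by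
  rcases hb.eq_or_lt with rfl | h
  · simp
  · exact (Real.self_lt_sinh_iff.mpr h).le

/-- One step of the moment recursion: up to the factor `exp (S²)` and a term that is linear in
`x`, adding a vector `x` of norm at most `S` does not increase `cosh ‖s‖`. The linear term has
mean zero when `x` does. -/
lemma cosh_norm_add_le (s x : E) {S : ℝ} (hx : ‖x‖ ≤ S) :
    Real.cosh ‖s + x‖ ≤ Real.cosh ‖s‖ * Real.exp (S ^ 2)
      + inner ℝ ((Real.sinh ‖s‖ / ‖s‖) • s) x := by
  have hexp : Real.exp ‖x‖ - ‖x‖ ≤ Real.exp (S ^ 2) :=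
    (exp_sub_le_exp_sq (norm_nonneg x)).trans (Real.exp_le_exp.mpr (by gcongr))
  have hcosh : Real.cosh ‖x‖ ≤ Real.exp ‖x‖ - ‖x‖ := by
    have := le_sinh_of_nonneg (norm_nonneg x)
    rw [← Real.cosh_add_sinh]; linarith
  rcases eq_or_ne s 0 with rfl | hs
  · simpa using hcosh.trans hexp
  rcases eq_or_ne x 0 with rfl | hx0
  · have := Real.one_le_exp (sq_nonneg S)
    have h2 := Real.cosh_pos ‖s‖
    simp only [add_zero, inner_zero_right]
    nlinarith
  have hs' : 0 < ‖s‖ := norm_pos_iff.mpr hs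
  have hx' : 0 < ‖x‖ := norm_pos_iff.mpr hx0
  set t : ℝ := inner ℝ s x / (‖s‖ * ‖x‖) with ht
  have hin : inner ℝ s x = t * (‖s‖ * ‖x‖) := by rw [ht]; field_simp
  have ht1 : |t| ≤ 1 := abs_real_inner_div_norm_mul_norm_le_one s x
  have h1 := cosh_le_of_sq_eq (a := ‖s‖) (b := ‖x‖) (c := ‖s + x‖) ht1 (by
    rw [norm_add_sq_real, hin]; ring)
  have h2 : inner ℝ ((Real.sinh ‖s‖ / ‖s‖) • s) x = t * (Real.sinh ‖s‖ * ‖x‖) := by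
    rw [real_inner_smul_left, hin]; field_simp
  rw [h2]
  have h3 : t * (Real.sinh ‖s‖ * (Real.sinh ‖x‖ - ‖x‖))
      ≤ Real.cosh ‖s‖ * (Real.sinh ‖x‖ - ‖x‖) := by
    have ha : 0 ≤ Real.sinh ‖x‖ - ‖x‖ := sub_nonneg.mpr (le_sinh_of_nonneg hx'.le)
    have hb : 0 ≤ Real.sinh ‖s‖ := Real.sinh_nonneg_iff.mpr hs'.le
    calc t * (Real.sinh ‖s‖ * (Real.sinh ‖x‖ - ‖x‖))
        ≤ 1 * (Real.sinh ‖s‖ * (Real.sinh ‖x‖ - ‖x‖)) :=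
          mul_le_mul_of_nonneg_right (abs_le.mp ht1).2 (mul_nonneg hb ha)
      _ ≤ _ := by
          rw [one_mul]
          exact mul_le_mul_of_nonneg_right (Real.sinh_lt_cosh _).le ha
  have h4 : Real.cosh ‖s‖ * (Real.exp ‖x‖ - ‖x‖) ≤ Real.cosh ‖s‖ * Real.exp (S ^ 2) :=
    mul_le_mul_of_nonneg_left hexp (Real.cosh_pos _).le
  rw [← Real.cosh_add_sinh] at h4
  linarith

variable {Z : Type*} [MeasurableSpace Z] {ρ : Measure Z} [IsProbabilityMeasure ρ]

lemma integrable_of_norm_le {G : Type*} [NormedAddCommGroup G] {f : Z → G}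
    (hf : StronglyMeasurable f) {S : ℝ} (hS : ∀ z, ‖f z‖ ≤ S) : Integrable f ρ :=
  .of_bound hf.aestronglyMeasurable S (.of_forall hS)

lemma stronglyMeasurable_sum_pi {G : Type*} [NormedAddCommGroup G] {f : Z → G}
    (hf : StronglyMeasurable f) (n : ℕ) :
    StronglyMeasurable fun z : Fin n → Z => ∑ i, f (z i) :=
  Finset.stronglyMeasurable_fun_sum _ fun i _ => hf.comp_measurable (measurable_pi_apply i)

variable [CompleteSpace E]

lemma lintegral_cosh_norm_add_le {f : Z → E} (hf : StronglyMeasurable f) {S : ℝ}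
    (hS : ∀ z, ‖f z‖ ≤ S) (h0 : ∫ z, f z ∂ρ = 0) (s : E) :
    ∫⁻ z, ENNReal.ofReal (Real.cosh ‖s + f z‖) ∂ρ
      ≤ ENNReal.ofReal (Real.cosh ‖s‖ * Real.exp (S ^ 2)) := by
  have hint : Integrable f ρ := integrable_of_norm_le hf hS
  set v : E := (Real.sinh ‖s‖ / ‖s‖) • s
  have hg : Integrable (fun z => Real.cosh ‖s‖ * Real.exp (S ^ 2) + inner ℝ v (f z)) ρ :=
    (integrable_const _).add (hint.const_inner v)
  calc ∫⁻ z, ENNReal.ofReal (Real.cosh ‖s + f z‖) ∂ρ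
      ≤ ∫⁻ z, ENNReal.ofReal (Real.cosh ‖s‖ * Real.exp (S ^ 2) + inner ℝ v (f z)) ∂ρ :=
        lintegral_mono fun z => ENNReal.ofReal_le_ofReal (cosh_norm_add_le s (f z) (hS z))
    _ = ENNReal.ofReal (∫ z, (Real.cosh ‖s‖ * Real.exp (S ^ 2) + inner ℝ v (f z)) ∂ρ) := by
        rw [ofReal_integral_eq_lintegral_ofReal hg]
        exact .of_forall fun z =>
          (Real.cosh_pos _).le.trans (cosh_norm_add_le s (f z) (hS z))
    _ = _ := by
        rw [integral_add (integrable_const _) (hint.const_inner v), integral_inner hint, h0]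
        simp

lemma lintegral_cosh_norm_sum_le {f : Z → E} (hf : StronglyMeasurable f) {S : ℝ}
    (hS : ∀ z, ‖f z‖ ≤ S) (h0 : ∫ z, f z ∂ρ = 0) (n : ℕ) (s : E) :
    ∫⁻ z : Fin n → Z, ENNReal.ofReal (Real.cosh ‖s + ∑ i, f (z i)‖) ∂(Measure.pi fun _ => ρ)
      ≤ ENNReal.ofReal (Real.cosh ‖s‖ * Real.exp (S ^ 2) ^ n) := by
  have hmeas : ∀ (k : ℕ) (s : E), Measurable fun z : Fin k → Z =>
      ENNReal.ofReal (Real.cosh ‖s + ∑ i, f (z i)‖) := fun k s =>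
    (Real.continuous_cosh.comp_stronglyMeasurable
      (stronglyMeasurable_const.add
        (stronglyMeasurable_sum_pi hf k)).norm).measurable.ennreal_ofReal
  induction n generalizing s with
  | zero => simp
  | succ n ih =>
    have hmp := measurePreserving_piFinSuccAbove (fun _ : Fin (n + 1) => ρ) 0
    have hm2 : Measurable fun p : Z × (Fin n → Z) =>
        ENNReal.ofReal (Real.cosh ‖s + (f p.1 + ∑ i, f (p.2 i))‖) :=
      (Real.continuous_cosh.comp_stronglyMeasurable
        (stronglyMeasurable_const.add ((hf.comp_measurable measurable_fst).add
          ((stronglyMeasurable_sum_pi hf n).comp_measurable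
            measurable_snd))).norm).measurable.ennreal_ofReal
    have h1 := hmp.lintegral_comp hm2
    have h2 : ∀ z : Fin (n + 1) → Z, ENNReal.ofReal (Real.cosh ‖s + ∑ i, f (z i)‖)
        = (fun p : Z × (Fin n → Z) => ENNReal.ofReal (Real.cosh ‖s + (f p.1 + ∑ i, f (p.2 i))‖))
          (MeasurableEquiv.piFinSuccAbove (fun _ => Z) 0 z) := by
      intro z
      simp [Fin.sum_univ_succ, MeasurableEquiv.piFinSuccAbove, Fin.tail]
    simp_rw [h2]
    rw [h1, lintegral_prod _ hm2.aemeasurable]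
    calc ∫⁻ x, ∫⁻ y : Fin n → Z, ENNReal.ofReal (Real.cosh ‖s + (f x + ∑ i, f (y i))‖)
            ∂(Measure.pi fun _ => ρ) ∂ρ
        ≤ ∫⁻ x, ENNReal.ofReal (Real.cosh ‖s + f x‖)
            * ENNReal.ofReal (Real.exp (S ^ 2) ^ n) ∂ρ := by
          refine lintegral_mono fun x => ?_
          simp_rw [← add_assoc]
          rw [← ENNReal.ofReal_mul (Real.cosh_pos _).le]
          exact ih (s + f x)
      _ ≤ ENNReal.ofReal (Real.cosh ‖s‖ * Real.exp (S ^ 2))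
            * ENNReal.ofReal (Real.exp (S ^ 2) ^ n) := by
          rw [lintegral_mul_const' _ _ ENNReal.ofReal_ne_top]
          gcongr
          exact lintegral_cosh_norm_add_le hf hS h0 s
      _ = _ := by
          rw [← ENNReal.ofReal_mul (by positivity)]
          congr 1
          ring

/-- A Hoeffding inequality for centred, bounded, independent vectors in a Hilbert space. -/
lemma measure_le_norm_average_le {f : Z → E} (hf : StronglyMeasurable f) {S : ℝ} (hS0 : 0 < S)
    (hS : ∀ z, ‖f z‖ ≤ S) (h0 : ∫ z, f z ∂ρ = 0) {n : ℕ} (hn : 0 < n) {t : ℝ} (ht : 0 ≤ t) :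
    (Measure.pi fun _ : Fin n => ρ) {z | t ≤ ‖(1 / (n : ℝ)) • ∑ i, f (z i)‖}
      ≤ ENNReal.ofReal (2 * Real.exp (-(n * t ^ 2 / (4 * S ^ 2)))) := by
  have hn' : (0 : ℝ) < n := by exact_mod_cast hn
  -- the minimizer of `r² S² - r t`
  set r : ℝ := t / (2 * S ^ 2) with hr
  have hr0 : 0 ≤ r := by positivity
  have hb : ∀ z, ‖(r • f) z‖ ≤ r * S := fun z => by
    rw [Pi.smul_apply, norm_smul, Real.norm_of_nonneg hr0]
    exact mul_le_mul_of_nonneg_left (hS z) hr0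
  have h0' : ∫ z, (r • f) z ∂ρ = 0 := by simp [integral_smul, h0]
  have hmain := lintegral_cosh_norm_sum_le (hf.const_smul r) hb h0' n 0
  simp only [zero_add, norm_zero, Real.cosh_zero, one_mul] at hmain
  set c : ℝ := Real.exp (r * (n * t)) / 2 with hc
  have hc0 : 0 < c := by positivity
  have hsub : {z : Fin n → Z | t ≤ ‖(1 / (n : ℝ)) • ∑ i, f (z i)‖}
      ⊆ {z | ENNReal.ofReal c ≤ ENNReal.ofReal (Real.cosh ‖∑ i, (r • f) (z i)‖)} := by
    intro z hz
    simp only [Set.mem_ofPred_eq] at hz ⊢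
    rw [norm_smul, Real.norm_of_nonneg (by positivity), one_div, inv_mul_eq_div,
      le_div_iff₀ hn'] at hz
    refine ENNReal.ofReal_le_ofReal ?_
    have h1 : ‖∑ i, (r • f) (z i)‖ = r * ‖∑ i, f (z i)‖ := by
      simp only [Pi.smul_apply, ← Finset.smul_sum]
      rw [norm_smul, Real.norm_of_nonneg hr0]
    rw [h1, Real.cosh_eq, hc]
    have h2 : Real.exp (r * (n * t)) ≤ Real.exp (r * ‖∑ i, f (z i)‖) := by
      refine Real.exp_le_exp.mpr (mul_le_mul_of_nonneg_left (by linarith) hr0)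
    have h3 := Real.exp_pos (-(r * ‖∑ i, f (z i)‖))
    linarith
  refine (measure_mono hsub).trans ?_
  refine (meas_ge_le_lintegral_div ?_ (by simpa using hc0) ENNReal.ofReal_ne_top).trans ?_
  · exact ((Real.continuous_cosh.comp_stronglyMeasurable
      (stronglyMeasurable_sum_pi (hf.const_smul r) n).norm).measurable.ennreal_ofReal).aemeasurable
  refine (ENNReal.div_le_div_right hmain _).trans ?_
  rw [← ENNReal.ofReal_div_of_pos hc0]
  refine ENNReal.ofReal_le_ofReal (le_of_eq ?_)
  rw [hc, ← Real.exp_nat_mul, div_div_eq_mul_div, mul_comm (Real.exp _) 2, mul_div_assoc,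
    ← Real.exp_sub]
  congr 2
  rw [hr]
  field_simp
  ring

/-- The Hilbert space Hoeffding inequality for functions of independent samples `z i` and of a
further independent variable `w`, in terms of the confidence level `d`. -/
lemma measure_le_norm_average_sub_integral_le {W Ω : Type*} [MeasurableSpace W] [MeasurableSpace Ω]
    {τ : Measure W} [IsProbabilityMeasure τ] {P : Measure Ω} {f : Z → W → E}
    (hf : StronglyMeasurable (Function.uncurry f)) {S : ℝ} (hS0 : 0 < S)
    (hS : ∀ z w, ‖f z w‖ ≤ S) {n : ℕ} (hn : 0 < n) {z : Fin n → Ω → Z} {w : Ω → W}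
    (hlaw : HasLaw (fun ω => ((fun i => z i ω), w ω)) ((Measure.pi fun _ : Fin n => ρ).prod τ) P)
    {t d : ℝ} (ht : 0 ≤ t) (hd : 0 < d) (htd : 16 * S ^ 2 * Real.log (2 / d) ≤ n * t ^ 2) :
    P {ω | t ≤ ‖(1 / (n : ℝ)) • ∑ i, f (z i ω) (w ω) - ∫ x, f x (w ω) ∂ρ‖} ≤ ENNReal.ofReal d := by
  have hn' : (n : ℝ) ≠ 0 := by exact_mod_cast hn.ne'
  set A : Set ((Fin n → Z) × W) :=
    {p | t ≤ ‖(1 / (n : ℝ)) • ∑ i, f (p.1 i) p.2 - ∫ x, f x p.2 ∂ρ‖} with hA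
  have hint : StronglyMeasurable fun w => ∫ x, f x w ∂ρ := hf.integral_prod_left
  have hAm : MeasurableSet A := by
    refine measurableSet_le measurable_const (StronglyMeasurable.norm ?_).measurable
    refine StronglyMeasurable.sub (StronglyMeasurable.const_smul ?_ _)
      (hint.comp_measurable measurable_snd)
    refine Finset.stronglyMeasurable_fun_sum _ fun i _ => ?_
    have hm : Measurable fun p : (Fin n → Z) × W => (p.1 i, p.2) :=
      ((measurable_pi_apply i).comp measurable_fst).prodMk measurable_snd
    exact hf.comp_measurable hm
  have hP : P {ω | t ≤ ‖(1 / (n : ℝ)) • ∑ i, f (z i ω) (w ω) - ∫ x, f x (w ω) ∂ρ‖}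
      = ((Measure.pi fun _ : Fin n => ρ).prod τ) A := by
    rw [← hlaw.map_eq, Measure.map_apply_of_aemeasurable hlaw.aemeasurable hAm]
    rfl
  rw [hP, Measure.prod_apply_symm hAm]
  have hslice : ∀ v, (Measure.pi fun _ : Fin n => ρ) ((fun x => (x, v)) ⁻¹' A)
      ≤ ENNReal.ofReal d := by
    intro v
    have hfv : StronglyMeasurable fun x => f x v := hf.comp_measurable measurable_prodMk_right
    have hi : Integrable (fun x => f x v) ρ := integrable_of_norm_le hfv fun x => hS x v
    have hmean : ‖∫ x, f x v ∂ρ‖ ≤ S := by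
      simpa using norm_integral_le_of_norm_le_const (μ := ρ) (.of_forall fun x => hS x v)
    have key := measure_le_norm_average_le (ρ := ρ) (f := fun x => f x v - ∫ y, f y v ∂ρ)
      (hfv.sub stronglyMeasurable_const) (S := 2 * S) (by positivity)
      (fun x => (norm_sub_le _ _).trans (by linarith [hS x v]))
      (by rw [integral_sub hi (integrable_const _)]; simp) hn ht
    have hset : (fun x => (x, v)) ⁻¹' A
        = {x : Fin n → Z | t ≤ ‖(1 / (n : ℝ)) • ∑ i, (f (x i) v - ∫ y, f y v ∂ρ)‖} := by
      ext x
      simp only [hA, Set.mem_preimage, Set.mem_ofPred_eq, Finset.sum_sub_distrib, Finset.sum_const,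
        Finset.card_univ, Fintype.card_fin, smul_sub, ← Nat.cast_smul_eq_nsmul ℝ, smul_smul]
      rw [one_div_mul_cancel hn', one_smul]
    rw [hset]
    refine key.trans (ENNReal.ofReal_le_ofReal ?_)
    have h1 : Real.log (2 / d) ≤ n * t ^ 2 / (4 * (2 * S) ^ 2) := by
      rw [le_div_iff₀ (by positivity)]; linarith
    calc 2 * Real.exp (-(n * t ^ 2 / (4 * (2 * S) ^ 2))) ≤ 2 * Real.exp (-Real.log (2 / d)) := by
          gcongr
      _ = d := by
          rw [Real.exp_neg, Real.exp_log (by positivity)]; field_simp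
  calc ∫⁻ v, (Measure.pi fun _ : Fin n => ρ) ((fun x => (x, v)) ⁻¹' A) ∂τ
      ≤ ∫⁻ _, ENNReal.ofReal d ∂τ := lintegral_mono hslice
    _ = ENNReal.ofReal d := by simp

end Concentration

/-! ### Risks as quadratic forms in the coefficients -/

section Gram

variable {Y : Type*} [NormedAddCommGroup Y] [InnerProductSpace ℝ Y] {ι : Type*} [Fintype ι]

/-- The Gram matrix of a finite family of vectors, as an element of the Hilbert space of matrices
with the Frobenius norm. -/
def gram (v : ι → Y) : EuclideanSpace ℝ (ι × ι) :=
  WithLp.toLp 2 fun p => inner ℝ (v p.1) (v p.2)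

/-- The rank one matrix `c cᵀ`. -/
def tensorSquare (c : ι → ℝ) : EuclideanSpace ℝ (ι × ι) :=
  WithLp.toLp 2 fun p => c p.1 * c p.2

lemma norm_gram_le (v : ι → Y) : ‖gram v‖ ≤ ∑ j, ‖v j‖ ^ 2 := by
  refine abs_le_of_sq_le_sq' ?_ (by positivity) |>.2
  rw [EuclideanSpace.norm_sq_eq, sq (∑ j, ‖v j‖ ^ 2), Finset.sum_mul_sum, Fintype.sum_prod_type]
  refine Finset.sum_le_sum fun i _ => Finset.sum_le_sum fun j _ => ?_
  rw [← mul_pow]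
  exact pow_le_pow_left₀ (norm_nonneg _) (norm_inner_le_norm _ _) 2

lemma norm_tensorSquare (c : ι → ℝ) : ‖tensorSquare c‖ = ∑ j, c j ^ 2 := by
  rw [← sq_eq_sq₀ (norm_nonneg _) (by positivity), EuclideanSpace.norm_sq_eq,
    sq (∑ j, c j ^ 2), Finset.sum_mul_sum, Fintype.sum_prod_type]
  simp [tensorSquare, mul_pow]

lemma norm_sq_sum_smul (c : ι → ℝ) (v : ι → Y) :
    ‖∑ j, c j • v j‖ ^ 2 = inner ℝ (tensorSquare c) (gram v) := by
  rw [← real_inner_self_eq_norm_sq, sum_inner, PiLp.inner_apply, Fintype.sum_prod_type]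
  refine Finset.sum_congr rfl fun i _ => ?_
  rw [inner_sum]
  refine Finset.sum_congr rfl fun j _ => ?_
  simp only [tensorSquare, gram, real_inner_smul_left, real_inner_smul_right]
  simp
  ring

lemma stronglyMeasurable_gram {Z : Type*} [MeasurableSpace Z] {v : Z → ι → Y}
    (hv : ∀ j, StronglyMeasurable fun z => v z j) : StronglyMeasurable fun z => gram (v z) := by
  have h : Measurable fun z => fun p : ι × ι => (inner ℝ (v z p.1) (v z p.2) : ℝ) :=
    measurable_pi_lambda _ fun p => ((hv p.1).inner (hv p.2)).measurable
  exact (PiLp.continuous_toLp 2 _).comp_stronglyMeasurable h.stronglyMeasurable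

/-- The expectation of a squared linear combination exceeds its empirical mean by at most the
deviation of the empirical Gram matrix times the squared norm of the coefficients, uniformly in
these. -/
lemma integral_norm_sq_sum_smul_le {Z : Type*} [MeasurableSpace Z] {ρ : Measure Z} {v : Z → ι → Y}
    (hv : Integrable (fun z => gram (v z)) ρ) {n : ℕ} (z : Fin n → Z) (c : ι → ℝ) :
    ∫ x, ‖∑ j, c j • v x j‖ ^ 2 ∂ρ ≤ (1 / (n : ℝ)) * ∑ i, ‖∑ j, c j • v (z i) j‖ ^ 2
      + ‖(1 / (n : ℝ)) • ∑ i, gram (v (z i)) - ∫ x, gram (v x) ∂ρ‖ * ∑ j, c j ^ 2 := by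
  simp_rw [norm_sq_sum_smul]
  rw [integral_inner hv, ← inner_sum, ← real_inner_smul_right, ← norm_tensorSquare, mul_comm]
  set u := (1 / (n : ℝ)) • ∑ i, gram (v (z i))
  set w := ∫ x, gram (v x) ∂ρ
  have h1 := real_inner_le_norm (tensorSquare c) (w - u)
  rw [inner_sub_right, norm_sub_rev] at h1
  linarith

end Gram

section Risk

variable {X T Y : Type*} [NormedAddCommGroup Y] [InnerProductSpace ℝ Y]

/-- The empirical risk `(1/n) ∑_i ‖F(a_i) - F_m(a_i; α)‖²`. -/
noncomputable def empRisk (φ : X → T → Y) (F : X → Y) {m n : ℕ} (θ : Fin m → T) (a : Fin n → X)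
    (α : EuclideanSpace ℝ (Fin m)) : ℝ :=
  (1 / (n : ℝ)) * ∑ i, ‖F (a i) - rfm φ θ α (a i)‖ ^ 2

/-- The population risk `E^{x ∼ ν} ‖F(x) - F_m(x; α)‖²`. -/
noncomputable def popRisk [MeasurableSpace X] (ν : Measure X) (φ : X → T → Y) (F : X → Y) {m : ℕ}
    (θ : Fin m → T) (α : EuclideanSpace ℝ (Fin m)) : ℝ :=
  ∫ x, ‖F x - rfm φ θ α x‖ ^ 2 ∂ν

/-- The target together with the features, scaled so that the sum of their squared norms stays
bounded as the number `m` of features grows. The residual `F - F_m` is linear in this family. -/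
noncomputable def augFeature (φ : X → T → Y) (F : X → Y) {m : ℕ} (θ : Fin m → T)
    (x : X) : Option (Fin m) → Y
  | none => F x
  | some j => (1 / √(m : ℝ)) • φ x (θ j)

/-- The coefficients of the residual `F - F_m` in the family `augFeature`. -/
noncomputable def augCoeff {m : ℕ} (α : EuclideanSpace ℝ (Fin m)) : Option (Fin m) → ℝ
  | none => 1
  | some j => -(1 / √(m : ℝ)) * α j

lemma sum_augCoeff_smul_augFeature (φ : X → T → Y) (F : X → Y) {m : ℕ} (θ : Fin m → T) (x : X)
    (α : EuclideanSpace ℝ (Fin m)) :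
    ∑ o, augCoeff α o • augFeature φ F θ x o = F x - rfm φ θ α x := by
  rw [Fintype.sum_option]
  simp only [augCoeff, augFeature, rfm, one_smul, Finset.smul_sum, sub_eq_add_neg,
    ← Finset.sum_neg_distrib]
  congr 1
  refine Finset.sum_congr rfl fun j _ => ?_
  rw [smul_smul, smul_smul, ← neg_smul]
  congr 1
  have h : 1 / √(m : ℝ) * (1 / √(m : ℝ)) = 1 / m := by
    rw [div_mul_div_comm, one_mul, Real.mul_self_sqrt (Nat.cast_nonneg m)]
  rw [← h]; ring

lemma sum_augCoeff_sq {m : ℕ} (α : EuclideanSpace ℝ (Fin m)) :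
    ∑ o, augCoeff α o ^ 2 = 1 + ‖α‖ ^ 2 / m := by
  rw [Fintype.sum_option, EuclideanSpace.norm_sq_eq, Finset.sum_div]
  simp only [augCoeff]
  congr 1
  · norm_num
  refine Finset.sum_congr rfl fun j _ => ?_
  rw [mul_pow, neg_sq, div_pow, Real.sq_sqrt (Nat.cast_nonneg m), Real.norm_eq_abs, sq_abs]
  ring

lemma sum_norm_augFeature_sq_le {φ : X → T → Y} {F : X → Y} {B : ℝ} (hF : ∀ x, ‖F x‖ ≤ B)
    (hφ : ∀ x t, ‖φ x t‖ ≤ B) {m : ℕ} (θ : Fin m → T) (x : X) :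
    ∑ o, ‖augFeature φ F θ x o‖ ^ 2 ≤ 2 * B ^ 2 := by
  rw [Fintype.sum_option]
  simp only [augFeature]
  have h1 : ‖F x‖ ^ 2 ≤ B ^ 2 := pow_le_pow_left₀ (norm_nonneg _) (hF x) 2
  have h2 : ∑ j, ‖(1 / √(m : ℝ)) • φ x (θ j)‖ ^ 2 ≤ ∑ _j : Fin m, 1 / (m : ℝ) * B ^ 2 := by
    refine Finset.sum_le_sum fun j _ => ?_
    rw [norm_smul, mul_pow, Real.norm_of_nonneg (by positivity), div_pow, one_pow,
      Real.sq_sqrt (Nat.cast_nonneg m)]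
    exact mul_le_mul_of_nonneg_left (pow_le_pow_left₀ (norm_nonneg _) (hφ _ _) 2) (by positivity)
  have h3 : ∑ _j : Fin m, 1 / (m : ℝ) * B ^ 2 ≤ B ^ 2 := by
    rw [Finset.sum_const, Finset.card_univ, Fintype.card_fin, nsmul_eq_mul, ← mul_assoc]
    refine mul_le_of_le_one_left (sq_nonneg _) ?_
    rw [mul_one_div]
    exact div_self_le_one _
  linarith

/-- The generalization gap is controlled by the deviation of the empirical Gram matrix. -/
lemma popRisk_le_empRisk_add [MeasurableSpace X] {ν : Measure X} {φ : X → T → Y} {F : X → Y}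
    {m n : ℕ} {θ : Fin m → T} {a : Fin n → X}
    (hg : Integrable (fun x => gram (augFeature φ F θ x)) ν) {t : ℝ}
    (ht : ‖(1 / (n : ℝ)) • ∑ i, gram (augFeature φ F θ (a i))
      - ∫ x, gram (augFeature φ F θ x) ∂ν‖ ≤ t) (α : EuclideanSpace ℝ (Fin m)) :
    popRisk ν φ F θ α ≤ empRisk φ F θ a α + t * (1 + ‖α‖ ^ 2 / m) := by
  have h := integral_norm_sq_sum_smul_le hg a (augCoeff α)
  simp only [sum_augCoeff_smul_augFeature, sum_augCoeff_sq] at h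
  refine h.trans (add_le_add le_rfl (mul_le_mul_of_nonneg_right ht (by positivity)))

lemma ridgeObjective_eq (φ : X → T → Y) (F : X → Y) {m n : ℕ} (hn : 0 < n) (θ : Fin m → T)
    (a : Fin n → X) (reg : ℝ) (α : EuclideanSpace ℝ (Fin m)) :
    ridgeObjective φ θ a (fun i => F (a i)) reg α
      = n / 2 * (empRisk φ F θ a α + reg / n * (‖α‖ ^ 2 / m)) := by
  have hn' : (n : ℝ) ≠ 0 := by exact_mod_cast hn.ne'
  rw [ridgeObjective, empRisk, ← Finset.mul_sum]
  rcases eq_or_ne (m : ℝ) 0 with h | h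
  · simp only [h, mul_zero, div_zero, zero_mul, add_zero]
    field_simp
  · field_simp

/-- The oracle inequality for trained coefficients. The regularization pays for the part of the
generalization gap that grows with the coefficients: this needs a gap `t` of the order of
the effective regularization `reg / n`. -/
lemma IsTrained.popRisk_le [MeasurableSpace X] {ν : Measure X} {φ : X → T → Y} {F : X → Y}
    {m n : ℕ} (hn : 0 < n) {θ : Fin m → T} {a : Fin n → X} {reg : ℝ} (hreg : 0 ≤ reg)
    {α : EuclideanSpace ℝ (Fin m)}
    (hα : IsTrained φ θ a (fun i => F (a i)) reg α) {t κ : ℝ} (hκ : 0 ≤ κ)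
    (htκ : t ≤ κ * (reg / n))
    (hgap : popRisk ν φ F θ α ≤ empRisk φ F θ a α + t * (1 + ‖α‖ ^ 2 / m))
    (β : EuclideanSpace ℝ (Fin m)) :
    popRisk ν φ F θ α ≤ (1 + κ) * (empRisk φ F θ a β + reg / n * (‖β‖ ^ 2 / m)) + t := by
  have hn' : (0 : ℝ) < n := by exact_mod_cast hn
  have h1 : ridgeObjective φ θ a (fun i => F (a i)) reg α
      ≤ ridgeObjective φ θ a (fun i => F (a i)) reg β := hα (Set.mem_univ β)
  rw [ridgeObjective_eq φ F hn, ridgeObjective_eq φ F hn,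
    mul_le_mul_iff_right₀ (by positivity)] at h1
  have he : 0 ≤ empRisk φ F θ a α := by unfold empRisk; positivity
  have hs : 0 ≤ ‖α‖ ^ 2 / m := by positivity
  have h2 : t * (‖α‖ ^ 2 / m) ≤ κ * (reg / n) * (‖α‖ ^ 2 / m) :=
    mul_le_mul_of_nonneg_right htκ hs
  have h3 := mul_le_mul_of_nonneg_left h1 hκ
  have h4 := mul_nonneg hκ he
  have h5 : 0 ≤ reg / n * (‖α‖ ^ 2 / m) := by positivity
  calc popRisk ν φ F θ α ≤ empRisk φ F θ a α + t * (1 + ‖α‖ ^ 2 / m) := hgap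
    _ ≤ (1 + κ) * (empRisk φ F θ a α + reg / n * (‖α‖ ^ 2 / m)) + t := by nlinarith
    _ ≤ _ := by gcongr

end Risk

/-! ### Density of feature averages -/

section Density

lemma norm_smul_feature_le {X T Y : Type*} [NormedAddCommGroup Y] [InnerProductSpace ℝ Y]
    {φ : X → T → Y} {B : ℝ} (hφB : ∀ x θ, ‖φ x θ‖ ≤ B) {h : T → ℝ} {M : ℝ} (hM : ∀ θ, |h θ| ≤ M)
    (x : X) (θ : T) : ‖h θ • φ x θ‖ ≤ M * B := by
  rw [norm_smul, Real.norm_eq_abs]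
  exact mul_le_mul (hM θ) (hφB x θ) (norm_nonneg _) ((abs_nonneg _).trans (hM θ))

variable {X T Y : Type*} [MeasurableSpace X] [MeasurableSpace T]
  [NormedAddCommGroup Y] [InnerProductSpace ℝ Y]

/-- The feature average `x ↦ E^{θ ∼ μ} [h(θ) φ(x; θ)]` with coefficient function `h`: the limit of
the random feature models with coefficients `h(θ_j)`, and an element of the RKHS. -/
noncomputable def featureAverage (φ : X → T → Y) (μ : Measure T) (h : T → ℝ) (x : X) : Y :=
  ∫ θ, h θ • φ x θ ∂μ

variable {ν : Measure X} [IsProbabilityMeasure ν] {μ : Measure T} [IsProbabilityMeasure μ]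
  {φ : X → T → Y} {B : ℝ}

lemma stronglyMeasurable_featureAverage (hφ : StronglyMeasurable (Function.uncurry φ))
    {h : T → ℝ} (hh : StronglyMeasurable h) : StronglyMeasurable (featureAverage φ μ h) :=
  StronglyMeasurable.integral_prod_right (f := fun x θ => h θ • φ x θ)
    ((hh.comp_measurable measurable_snd).smul hφ)

lemma norm_featureAverage_le {X : Type*} {φ : X → T → Y} (hφB : ∀ x θ, ‖φ x θ‖ ≤ B)
    {h : T → ℝ} {M : ℝ} (hM : ∀ θ, |h θ| ≤ M) (x : X) : ‖featureAverage φ μ h x‖ ≤ M * B := by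
  simpa [featureAverage] using norm_integral_le_of_norm_le_const (μ := μ)
    (.of_forall fun θ => norm_smul_feature_le hφB hM x θ)

lemma integrable_smul_feature (hφ : StronglyMeasurable (Function.uncurry φ))
    (hφB : ∀ x θ, ‖φ x θ‖ ≤ B) {h : T → ℝ} (hh : StronglyMeasurable h) {M : ℝ}
    (hM : ∀ θ, |h θ| ≤ M) (x : X) : Integrable (fun θ => h θ • φ x θ) μ :=
  integrable_of_norm_le (hh.smul (hφ.comp_measurable measurable_prodMk_left))
    fun θ => norm_smul_feature_le hφB hM x θ

/-- Applying `k_μ(x, ·)` to a vector gives a feature average. -/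
lemma featureKernel_apply (hφ : StronglyMeasurable (Function.uncurry φ))
    (hφB : ∀ x θ, ‖φ x θ‖ ≤ B) [CompleteSpace Y] (x x' : X) (c : Y) :
    featureKernel φ μ x x' c = featureAverage φ μ (fun θ => inner ℝ (φ x' θ) c) x := by
  have hm : ∀ y, StronglyMeasurable (φ y) := fun y => hφ.comp_measurable measurable_prodMk_left
  have hB : ∀ y θ, ‖φ y θ‖ ≤ |B| := fun y θ => (hφB y θ).trans (le_abs_self B)
  rw [featureKernel, ContinuousLinearMap.integral_apply]
  · simp [featureAverage, InnerProductSpace.rankOne_apply]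
  refine integrable_of_norm_le (S := |B| * |B|) ?_ fun θ => ?_
  · have hc : Continuous fun p : Y × Y => InnerProductSpace.rankOne ℝ p.1 p.2 :=
      (InnerProductSpace.rankOne ℝ : Y →L[ℝ] Y →L⋆[ℝ] Y →L[ℝ] Y).continuous₂
    exact hc.comp_stronglyMeasurable ((hm x).prodMk (hm x'))
  · rw [InnerProductSpace.norm_rankOne]
    exact mul_le_mul (hB x θ) (hB x' θ) (norm_nonneg _) (abs_nonneg B)

/-- The space of classes of feature averages with bounded measurable coefficients. -/
def featureAverageSubmodule (ν : Measure X) (μ : Measure T) [IsProbabilityMeasure μ]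
    (hφ : StronglyMeasurable (Function.uncurry φ)) (hφB : ∀ x θ, ‖φ x θ‖ ≤ B) :
    Submodule ℝ (Lp Y 2 ν) where
  carrier := {u | ∃ (h : T → ℝ) (M : ℝ), StronglyMeasurable h ∧ (∀ θ, |h θ| ≤ M) ∧
    u =ᵐ[ν] featureAverage φ μ h}
  zero_mem' := by
    refine ⟨0, 0, stronglyMeasurable_zero, by simp, ?_⟩
    refine (Lp.coeFn_zero Y 2 ν).trans (.of_forall fun x => ?_)
    simp [featureAverage]
  add_mem' := by
    rintro u v ⟨h, M, hh, hM, hu⟩ ⟨h', M', hh', hM', hv⟩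
    refine ⟨h + h', M + M', hh.add hh', fun θ => (abs_add_le _ _).trans
      (add_le_add (hM θ) (hM' θ)), ?_⟩
    filter_upwards [Lp.coeFn_add u v, hu, hv] with x hx hux hvx
    rw [hx, Pi.add_apply, hux, hvx]
    simp only [featureAverage, Pi.add_apply, add_smul]
    exact (integral_add (integrable_smul_feature hφ hφB hh hM x)
      (integrable_smul_feature hφ hφB hh' hM' x)).symm
  smul_mem' := by
    rintro c u ⟨h, M, hh, hM, hu⟩
    refine ⟨c • h, |c| * M, hh.const_smul c, fun θ => ?_, ?_⟩
    · rw [Pi.smul_apply, smul_eq_mul, abs_mul]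
      exact mul_le_mul_of_nonneg_left (hM θ) (abs_nonneg c)
    filter_upwards [Lp.coeFn_smul c u, hu] with x hx hux
    rw [hx, Pi.smul_apply, hux]
    simp only [featureAverage, Pi.smul_apply, smul_assoc]
    exact (integral_smul c _).symm

/-- If `T_k` is injective on `L²_ν(X; Y)`, then the feature averages with bounded coefficients are
dense there: for `g` orthogonal to all of them, the coefficients `h(θ) = E^ν ⟪φ(·; θ), g⟫` show
that `h = 0` almost everywhere, while `T_k g` is the feature average of `h`. -/
lemma featureAverageSubmodule_topologicalClosure [CompleteSpace Y]
    (hφ : StronglyMeasurable (Function.uncurry φ)) (hφB : ∀ x θ, ‖φ x θ‖ ≤ B)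
    (hinj : KernelIntegralInjective (featureKernel φ μ) ν) :
    (featureAverageSubmodule ν μ hφ hφB).topologicalClosure = ⊤ := by
  rw [Submodule.topologicalClosure_eq_top_iff, Submodule.eq_bot_iff]
  intro g hg
  have hgm : StronglyMeasurable g := Lp.stronglyMeasurable g
  have hgi : Integrable g ν := (Lp.memLp g).integrable one_le_two
  have hin : ∀ x θ, |(inner ℝ (φ x θ) (g x) : ℝ)| ≤ B * ‖g x‖ := fun x θ =>
    (abs_real_inner_le_norm _ _).trans (mul_le_mul_of_nonneg_right (hφB x θ) (norm_nonneg _))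
  have hinm : StronglyMeasurable fun p : X × T => (inner ℝ (φ p.1 p.2) (g p.1) : ℝ) :=
    hφ.inner (hgm.comp_measurable measurable_fst)
  set h : T → ℝ := fun θ => ∫ x, inner ℝ (φ x θ) (g x) ∂ν
  set M : ℝ := ∫ x, B * ‖g x‖ ∂ν
  have hhm : StronglyMeasurable h := hinm.integral_prod_left'
  have hM : ∀ θ, |h θ| ≤ M := fun θ => by
    rw [← Real.norm_eq_abs]
    exact norm_integral_le_of_norm_le (hgi.norm.const_mul B) (.of_forall fun x => hin x θ)
  have hu : MemLp (featureAverage φ μ h) 2 ν :=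
    .of_bound (stronglyMeasurable_featureAverage hφ hhm).aestronglyMeasurable (M * B)
      (.of_forall (norm_featureAverage_le hφB hM))
  have horth : inner ℝ (hu.toLp _) g = 0 :=
    hg _ ⟨h, M, hhm, hM, hu.coeFn_toLp⟩
  have hsq : ∫ θ, h θ ^ 2 ∂μ = 0 := by
    rw [← horth, L2.inner_def]
    have h1 : ∫ x, inner ℝ (hu.toLp _ x) (g x) ∂ν
        = ∫ x, ∫ θ, h θ * inner ℝ (φ x θ) (g x) ∂μ ∂ν := by
      refine integral_congr_ae ?_
      filter_upwards [hu.coeFn_toLp] with x hx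
      rw [hx, featureAverage, real_inner_comm,
        ← integral_inner (integrable_smul_feature hφ hφB hhm hM x)]
      refine integral_congr_ae (.of_forall fun θ => ?_)
      simp only [real_inner_smul_right]
      rw [real_inner_comm]
    rw [h1, integral_integral_swap]
    · refine integral_congr_ae (.of_forall fun θ => ?_)
      simp only [integral_const_mul]
      rw [sq]
    refine Integrable.mono' ((hgi.norm.const_mul (M * B)).comp_fst μ)
      ((hhm.comp_measurable measurable_snd).mul hinm).aestronglyMeasurable
      (.of_forall fun p => ?_)
    simp only [Function.uncurry]
    rw [norm_mul, mul_assoc]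
    exact mul_le_mul (hM p.2) (hin p.1 p.2) (norm_nonneg _) ((abs_nonneg _).trans (hM p.2))
  have hzero : h =ᵐ[μ] 0 := by
    have hi : Integrable (fun θ => h θ ^ 2) μ := by
      refine integrable_of_norm_le (hhm.pow 2) (S := M ^ 2) fun θ => ?_
      rw [norm_pow]
      exact pow_le_pow_left₀ (norm_nonneg _) (hM θ) 2
    filter_upwards [(integral_eq_zero_iff_of_nonneg (fun θ => sq_nonneg (h θ)) hi).mp hsq] with θ hθ
    simpa using hθ
  have hT : ∀ x, kernelIntegral (featureKernel φ μ) ν g x = 0 := by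
    intro x
    simp only [kernelIntegral, featureKernel_apply hφ hφB, featureAverage]
    rw [integral_integral_swap]
    · simp only [integral_smul_const]
      refine integral_eq_zero_of_ae ?_
      filter_upwards [hzero] with θ hθ
      have : ∫ x, inner ℝ (φ x θ) (g x) ∂ν = 0 := hθ
      simp [this]
    refine Integrable.mono' ((hgi.norm.const_mul (B * B)).comp_fst μ)
      (hinm.smul ((hφ.comp_measurable measurable_prodMk_left).comp_measurable
        measurable_snd)).aestronglyMeasurable (.of_forall fun p => ?_)
    simp only [Function.uncurry]
    rw [norm_smul, mul_right_comm]
    exact mul_le_mul (hin p.1 p.2) (hφB x p.2) (norm_nonneg _) ((abs_nonneg _).trans (hin p.1 p.2))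
  refine hinj g 0 (.of_forall fun x => ?_)
  rw [hT x]
  simp [kernelIntegral]

lemma exists_integral_norm_sub_featureAverage_sq_lt [CompleteSpace Y]
    (hφ : StronglyMeasurable (Function.uncurry φ)) (hφB : ∀ x θ, ‖φ x θ‖ ≤ B)
    (hinj : KernelIntegralInjective (featureKernel φ μ) ν) {F : X → Y} (hF : MemLp F 2 ν)
    {ε : ℝ} (hε : 0 < ε) :
    ∃ (h : T → ℝ) (M : ℝ), StronglyMeasurable h ∧ (∀ θ, |h θ| ≤ M) ∧
      ∫ x, ‖F x - featureAverage φ μ h x‖ ^ 2 ∂ν < ε := by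
  have hmem : hF.toLp F ∈ closure (featureAverageSubmodule ν μ hφ hφB : Set (Lp Y 2 ν)) := by
    rw [← Submodule.topologicalClosure_coe,
      featureAverageSubmodule_topologicalClosure hφ hφB hinj]
    trivial
  obtain ⟨u, ⟨h, M, hh, hM, hu⟩, hdist⟩ :=
    Metric.mem_closure_iff.mp hmem (√ε) (Real.sqrt_pos.mpr hε)
  refine ⟨h, M, hh, hM, ?_⟩
  have h1 : ∫ x, ‖F x - featureAverage φ μ h x‖ ^ 2 ∂ν = ‖hF.toLp F - u‖ ^ 2 := by
    rw [← real_inner_self_eq_norm_sq, L2.inner_def]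
    refine integral_congr_ae ?_
    filter_upwards [Lp.coeFn_sub (hF.toLp F) u, hF.coeFn_toLp, hu] with x hx hFx hux
    rw [hx, Pi.sub_apply, hFx, hux, real_inner_self_eq_norm_sq]
  rw [h1, ← dist_eq_norm]
  exact (Real.lt_sqrt dist_nonneg).mp hdist

end Density

/-! ### High probability bounds for the empirical quantities -/

section Events

variable {X T Y : Type*} [MeasurableSpace X] [MeasurableSpace T]
  [NormedAddCommGroup Y] [InnerProductSpace ℝ Y]
  {ν : Measure X} [IsProbabilityMeasure ν] {μ : Measure T} [IsProbabilityMeasure μ]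
  {φ : X → T → Y} {F : X → Y} {B : ℝ}
  {Ω : Type*} [MeasurableSpace Ω] {P : Measure Ω} {m n : ℕ} {a : Fin n → Ω → X} {θ : Fin m → Ω → T}

lemma stronglyMeasurable_gram_augFeature (hφ : StronglyMeasurable (Function.uncurry φ))
    (hF : StronglyMeasurable F) (m : ℕ) :
    StronglyMeasurable fun p : X × (Fin m → T) => gram (augFeature φ F p.2 p.1) := by
  refine stronglyMeasurable_gram (v := fun p : X × (Fin m → T) => augFeature φ F p.2 p.1)
    fun o => ?_
  cases o with
  | none => exact hF.comp_measurable measurable_fst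
  | some j =>
    have hm : Measurable fun p : X × (Fin m → T) => (p.1, p.2 j) :=
      measurable_fst.prodMk ((measurable_pi_apply j).comp measurable_snd)
    exact (hφ.comp_measurable hm).const_smul (1 / √(m : ℝ))

lemma norm_gram_augFeature_le {X T : Type*} {φ : X → T → Y} {F : X → Y}
    (hφB : ∀ x t, ‖φ x t‖ ≤ B) (hFB : ∀ x, ‖F x‖ ≤ B)
    (t : Fin m → T) (x : X) : ‖gram (augFeature φ F t x)‖ ≤ 2 * B ^ 2 :=
  (norm_gram_le _).trans (sum_norm_augFeature_sq_le hFB hφB t x)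

lemma integrable_gram_augFeature (hφ : StronglyMeasurable (Function.uncurry φ))
    (hφB : ∀ x t, ‖φ x t‖ ≤ B) (hF : StronglyMeasurable F) (hFB : ∀ x, ‖F x‖ ≤ B)
    (t : Fin m → T) : Integrable (fun x => gram (augFeature φ F t x)) ν :=
  integrable_of_norm_le
    ((stronglyMeasurable_gram_augFeature hφ hF m).comp_measurable
      (measurable_prodMk_right (y := t))) (norm_gram_augFeature_le hφB hFB t)

/-- Conditionally on the feature parameters, the empirical Gram matrix concentrates at the
dimension free rate `n^{-1/2}`. -/
lemma measure_gram_deviation_le (hB : 0 < B) (hφ : StronglyMeasurable (Function.uncurry φ))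
    (hφB : ∀ x t, ‖φ x t‖ ≤ B) (hF : StronglyMeasurable F) (hFB : ∀ x, ‖F x‖ ≤ B) (hn : 0 < n)
    (hlaw : HasLaw (fun ω => ((fun i => a i ω), (fun j => θ j ω)))
      ((Measure.pi fun _ : Fin n => ν).prod (Measure.pi fun _ : Fin m => μ)) P)
    {t d : ℝ} (ht : 0 ≤ t) (hd : 0 < d)
    (htd : 16 * (2 * B ^ 2) ^ 2 * Real.log (2 / d) ≤ n * t ^ 2) :
    P {ω | t ≤ ‖(1 / (n : ℝ)) • ∑ i, gram (augFeature φ F (fun j => θ j ω) (a i ω))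
      - ∫ x, gram (augFeature φ F (fun j => θ j ω) x) ∂ν‖} ≤ ENNReal.ofReal d :=
  measure_le_norm_average_sub_integral_le (f := fun x t => gram (augFeature φ F t x))
    (stronglyMeasurable_gram_augFeature hφ hF m) (by positivity)
    (fun x t => norm_gram_augFeature_le hφB hFB t x) hn hlaw ht hd htd

lemma measure_empirical_norm_sq_deviation_le {G : Type*} [NormedAddCommGroup G] {ψ : X → G}
    (hψ : StronglyMeasurable ψ) (hB : 0 < B)
    (hψB : ∀ x, ‖ψ x‖ ≤ B) (hn : 0 < n)
    (hlaw : HasLaw (fun ω => ((fun i => a i ω), (fun j => θ j ω)))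
      ((Measure.pi fun _ : Fin n => ν).prod (Measure.pi fun _ : Fin m => μ)) P)
    {t d : ℝ} (ht : 0 ≤ t) (hd : 0 < d)
    (htd : 16 * (B ^ 2) ^ 2 * Real.log (2 / d) ≤ n * t ^ 2) :
    P {ω | t ≤ ‖(1 / (n : ℝ)) • ∑ i, ‖ψ (a i ω)‖ ^ 2 - ∫ x, ‖ψ x‖ ^ 2 ∂ν‖} ≤ ENNReal.ofReal d := by
  have hm : StronglyMeasurable fun x => ‖ψ x‖ ^ 2 := hψ.norm.pow 2
  refine measure_le_norm_average_sub_integral_le (f := fun x (_ : Fin m → T) => ‖ψ x‖ ^ 2)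
    (hm.comp_measurable measurable_fst) (by positivity) (fun x t => ?_) hn hlaw ht hd htd
  rw [norm_pow, norm_norm]
  exact pow_le_pow_left₀ (norm_nonneg _) (hψB x) 2

/-- The coefficients `h(θ_j)`, which make the random feature model a Monte Carlo approximation of
`featureAverage φ μ h`. -/
def oracleCoeff (h : T → ℝ) {m : ℕ} (t : Fin m → T) : EuclideanSpace ℝ (Fin m) :=
  WithLp.toLp 2 fun j => h (t j)

lemma norm_oracleCoeff_sq_div_le {T : Type*} {m : ℕ} {h : T → ℝ} {M : ℝ}
    (hM : ∀ θ, |h θ| ≤ M) (t : Fin m → T) :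
    ‖oracleCoeff h t‖ ^ 2 / m ≤ M ^ 2 := by
  rw [EuclideanSpace.norm_sq_eq]
  have h1 : ∑ j, ‖oracleCoeff h t j‖ ^ 2 ≤ ∑ _j : Fin m, M ^ 2 :=
    Finset.sum_le_sum fun j _ => pow_le_pow_left₀ (norm_nonneg _) (hM (t j)) 2
  rw [Finset.sum_const, Finset.card_univ, Fintype.card_fin, nsmul_eq_mul] at h1
  refine div_le_of_le_mul₀ (by positivity) (by positivity) ?_
  linarith

/-- The Monte Carlo error of `oracleCoeff` on the sample, a mean of independent vectors in `Y ^ n`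
conditionally on the sample. -/
lemma measure_oracle_deviation_le [CompleteSpace Y] [TopologicalSpace.SeparableSpace Y]
    (hB : 0 < B) (hφ : StronglyMeasurable (Function.uncurry φ)) (hφB : ∀ x t, ‖φ x t‖ ≤ B)
    {h : T → ℝ} (hh : StronglyMeasurable h) {M : ℝ} (hM0 : 0 < M) (hM : ∀ θ, |h θ| ≤ M)
    (hm : 0 < m) (hn : 0 < n)
    (hlaw : HasLaw (fun ω => ((fun i => a i ω), (fun j => θ j ω)))
      ((Measure.pi fun _ : Fin n => ν).prod (Measure.pi fun _ : Fin m => μ)) P)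
    {t d : ℝ} (ht : 0 ≤ t) (hd : 0 < d)
    (htd : 16 * (M * B) ^ 2 * Real.log (2 / d) ≤ m * t) :
    P {ω | t ≤ (1 / (n : ℝ)) * ∑ i, ‖rfm φ (fun j => θ j ω) (oracleCoeff h fun j => θ j ω) (a i ω)
      - featureAverage φ μ h (a i ω)‖ ^ 2} ≤ ENNReal.ofReal d := by
  have hn' : (0 : ℝ) < n := by exact_mod_cast hn
  borelize Y
  have := UniformSpace.secondCountable_of_separable Y
  set f : T → (Fin n → X) → PiLp 2 (fun _ : Fin n => Y) :=
    fun s x => WithLp.toLp 2 fun i => h s • φ (x i) s with hf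
  have hfm : StronglyMeasurable (Function.uncurry f) := by
    have h1 : Measurable fun p : T × (Fin n → X) => fun i => h p.1 • φ (p.2 i) p.1 := by
      refine measurable_pi_lambda _ fun i => ?_
      have hm : Measurable fun p : T × (Fin n → X) => (p.2 i, p.1) :=
        ((measurable_pi_apply i).comp measurable_snd).prodMk measurable_fst
      exact ((hh.comp_measurable measurable_fst).smul (hφ.comp_measurable hm)).measurable
    exact (PiLp.continuous_toLp 2 _).comp_stronglyMeasurable h1.stronglyMeasurable
  have hfB : ∀ s x, ‖f s x‖ ≤ √n * (M * B) := by
    intro s x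
    refine abs_le_of_sq_le_sq' ?_ (by positivity) |>.2
    rw [PiLp.norm_sq_eq_of_L2, mul_pow, Real.sq_sqrt hn'.le]
    have h1 : ∑ i, ‖f s x i‖ ^ 2 ≤ ∑ _i : Fin n, (M * B) ^ 2 :=
      Finset.sum_le_sum fun i _ =>
        pow_le_pow_left₀ (norm_nonneg _) (norm_smul_feature_le hφB hM (x i) s) 2
    simpa using h1
  have hswap : HasLaw (fun ω => ((fun j => θ j ω), (fun i => a i ω)))
      ((Measure.pi fun _ : Fin m => μ).prod (Measure.pi fun _ : Fin n => ν)) P :=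
    (Measure.measurePreserving_swap.hasLaw).comp hlaw
  have key := measure_le_norm_average_sub_integral_le (t := √(n * t)) hfm
    (S := √n * (M * B)) (by positivity) hfB hm hswap (Real.sqrt_nonneg _) hd (by
      rw [mul_pow, Real.sq_sqrt hn'.le, Real.sq_sqrt (by positivity)]
      nlinarith)
  refine (measure_mono fun ω hω => ?_).trans key
  simp only [Set.mem_ofPred_eq] at hω ⊢
  set x : Fin n → X := fun i => a i ω
  have hint : Integrable (fun s => f s x) μ :=
    integrable_of_norm_le (hfm.comp_measurable measurable_prodMk_right) fun s => hfB s x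
  have hcoord : ∀ i, ((1 / (m : ℝ)) • ∑ j, f (θ j ω) x - ∫ s, f s x ∂μ) i
      = rfm φ (fun j => θ j ω) (oracleCoeff h fun j => θ j ω) (a i ω)
        - featureAverage φ μ h (a i ω) := by
    intro i
    have h1 : (∫ s, f s x ∂μ) i = featureAverage φ μ h (a i ω) :=
      ((PiLp.proj (𝕜 := ℝ) 2 (fun _ : Fin n => Y) i).integral_comp_comm hint).symm
    rw [PiLp.sub_apply, h1, PiLp.smul_apply]
    have h2 : (∑ j, f (θ j ω) x) i = ∑ j, f (θ j ω) x i :=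
      map_sum (PiLp.proj (𝕜 := ℝ) 2 (fun _ : Fin n => Y) i) _ _
    rw [h2]
    rfl
  refine Real.sqrt_le_iff.mpr ⟨norm_nonneg _, ?_⟩
  rw [PiLp.norm_sq_eq_of_L2]
  simp_rw [hcoord]
  rw [one_div, inv_mul_eq_div, le_div_iff₀ hn'] at hω
  linarith

end Events

/-! ### Almost sure consistency for bounded features -/

section Consistency

/-- The relations between the sizes `m l`, `n l`, the regularization and the confidence levels
`δ l`. -/
lemma exists_rates {δ : ℕ → ℝ} (hδ : ∀ l, δ l ∈ Set.Ioo (0 : ℝ) 1) {m n : ℕ → ℕ} {reg : ℕ → ℝ}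
    (hm : TwoSidedBound (fun l => (m l : ℝ)) (fun l => (δ l)⁻¹ * Real.log (2 / δ l)))
    (hn : TwoSidedBound (fun l => (n l : ℝ)) (fun l => ((δ l) ^ 2)⁻¹ * Real.log (2 / δ l)))
    (hreg : TwoSidedBound reg (fun l => (m l : ℝ))) :
    (∀ l, 0 < m l ∧ 0 < n l ∧ 0 ≤ reg l) ∧ ∃ c C : ℝ, 0 < c ∧ 0 < C ∧ ∀ l,
      c * Real.log (2 / δ l) ≤ n l * δ l ^ 2 ∧ c * Real.log (2 / δ l) ≤ m l * δ l ∧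
      c * δ l ≤ reg l / n l ∧ reg l / n l ≤ C * δ l := by
  obtain ⟨c₁, C₁, hc₁, hC₁, h₁⟩ := hm
  obtain ⟨c₂, C₂, hc₂, hC₂, h₂⟩ := hn
  obtain ⟨c₃, C₃, hc₃, hC₃, h₃⟩ := hreg
  have hL : ∀ l, 0 < Real.log (2 / δ l) := fun l =>
    Real.log_pos ((one_lt_div (hδ l).1).mpr (by linarith [(hδ l).2]))
  have hm0 : ∀ l, (0 : ℝ) < m l := fun l =>
    lt_of_lt_of_le (mul_pos hc₁ (mul_pos (inv_pos.mpr (hδ l).1) (hL l))) (h₁ l).1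
  have hn0 : ∀ l, (0 : ℝ) < n l := fun l =>
    lt_of_lt_of_le (mul_pos hc₂ (mul_pos (inv_pos.mpr (pow_pos (hδ l).1 2)) (hL l))) (h₂ l).1
  refine ⟨fun l => ⟨by exact_mod_cast hm0 l, by exact_mod_cast hn0 l,
    (mul_pos hc₃ (hm0 l)).le.trans (h₃ l).1⟩, min (min c₁ c₂) (c₃ * c₁ / C₂), C₃ * C₁ / c₂,
    by positivity, by positivity, fun l => ?_⟩
  have hd := (hδ l).1
  have hLl := hL l
  obtain ⟨h₁a, h₁b⟩ := h₁ l
  obtain ⟨h₂a, h₂b⟩ := h₂ l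
  obtain ⟨h₃a, h₃b⟩ := h₃ l
  have e1 : ((δ l) ^ 2)⁻¹ * Real.log (2 / δ l) * δ l ^ 2 = Real.log (2 / δ l) := by field_simp
  have e2 : (δ l)⁻¹ * Real.log (2 / δ l) * δ l = Real.log (2 / δ l) := by field_simp
  have e3 : δ l * (((δ l) ^ 2)⁻¹ * Real.log (2 / δ l)) = (δ l)⁻¹ * Real.log (2 / δ l) := by
    field_simp
  refine ⟨?_, ?_, ?_, ?_⟩
  · calc _ ≤ c₂ * Real.log (2 / δ l) := by
          gcongr; exact (min_le_left _ _).trans (min_le_right _ _)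
      _ = c₂ * (((δ l) ^ 2)⁻¹ * Real.log (2 / δ l)) * δ l ^ 2 := by rw [mul_assoc, e1]
      _ ≤ _ := by gcongr
  · calc _ ≤ c₁ * Real.log (2 / δ l) := by
          gcongr; exact (min_le_left _ _).trans (min_le_left _ _)
      _ = c₁ * ((δ l)⁻¹ * Real.log (2 / δ l)) * δ l := by rw [mul_assoc, e2]
      _ ≤ _ := by gcongr
  · rw [le_div_iff₀ (hn0 l)]
    calc _ ≤ c₃ * c₁ / C₂ * δ l * (C₂ * (((δ l) ^ 2)⁻¹ * Real.log (2 / δ l))) := by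
          gcongr; exact min_le_right _ _
      _ = c₃ * (c₁ * (δ l * (((δ l) ^ 2)⁻¹ * Real.log (2 / δ l)))) := by field_simp
      _ ≤ _ := by rw [e3]; exact (mul_le_mul_of_nonneg_left h₁a hc₃.le).trans h₃a
  · rw [div_le_iff₀ (hn0 l)]
    calc reg l ≤ C₃ * (C₁ * (δ l * (((δ l) ^ 2)⁻¹ * Real.log (2 / δ l)))) := by
          rw [e3]; exact h₃b.trans (mul_le_mul_of_nonneg_left h₁b hC₃.le)
      _ = C₃ * C₁ / c₂ * δ l * (c₂ * (((δ l) ^ 2)⁻¹ * Real.log (2 / δ l))) := by field_simp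
      _ ≤ _ := by gcongr

/-- A version of the first Borel-Cantelli lemma. -/
lemma ae_eventually_notMem_of_summable {Ω : Type*} [MeasurableSpace Ω] {P : Measure Ω} {δ : ℕ → ℝ}
    (hδ : ∀ l, 0 ≤ δ l) (hδsum : Summable δ) {s : ℕ → Set Ω}
    (hs : ∀ l, P (s l) ≤ ENNReal.ofReal (δ l)) : ∀ᵐ ω ∂P, ∀ᶠ l in atTop, ω ∉ s l := by
  refine ae_eventually_notMem (ne_top_of_le_ne_top ?_ (ENNReal.tsum_le_tsum hs))
  rw [← ENNReal.ofReal_tsum_of_nonneg hδ hδsum]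
  exact ENNReal.ofReal_ne_top

variable {X T Y : Type*} [MeasurableSpace X] [MeasurableSpace T]
  [NormedAddCommGroup Y] [InnerProductSpace ℝ Y]
  {ν : Measure X} [IsProbabilityMeasure ν] {μ : Measure T} [IsProbabilityMeasure μ]
  {φ : X → T → Y} {F : X → Y} {B : ℝ}

/-- The triangle inequality for the empirical risk, through an intermediate function `G`. -/
lemma empRisk_le {X T Y : Type*} [NormedAddCommGroup Y] [InnerProductSpace ℝ Y] (φ : X → T → Y)
    (F G : X → Y) {m n : ℕ} (θ : Fin m → T) (a : Fin n → X) (α : EuclideanSpace ℝ (Fin m)) :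
    empRisk φ F θ a α ≤ 2 * ((1 / (n : ℝ)) * ∑ i, ‖F (a i) - G (a i)‖ ^ 2)
      + 2 * ((1 / (n : ℝ)) * ∑ i, ‖rfm φ θ α (a i) - G (a i)‖ ^ 2) := by
  have h : ∀ u v w : Y, ‖u - w‖ ^ 2 ≤ 2 * ‖u - v‖ ^ 2 + 2 * ‖w - v‖ ^ 2 := fun u v w => by
    have h1 : ‖u - w‖ ≤ ‖u - v‖ + ‖w - v‖ := by
      rw [norm_sub_rev w v]; exact norm_sub_le_norm_sub_add_norm_sub u v w
    nlinarith [sq_nonneg (‖u - v‖ - ‖w - v‖), norm_nonneg (u - w)]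
  calc empRisk φ F θ a α ≤ (1 / (n : ℝ)) * ∑ i, (2 * ‖F (a i) - G (a i)‖ ^ 2
        + 2 * ‖rfm φ θ α (a i) - G (a i)‖ ^ 2) :=
        mul_le_mul_of_nonneg_left (Finset.sum_le_sum fun i _ => h _ _ _) (by positivity)
    _ = _ := by rw [Finset.sum_add_distrib, ← Finset.mul_sum, ← Finset.mul_sum]; ring

variable [CompleteSpace Y] [TopologicalSpace.SeparableSpace Y]
  {δ : ℕ → ℝ} {m n : ℕ → ℕ} {reg : ℕ → ℝ}
  {Ω : Type*} [MeasurableSpace Ω] {P : Measure Ω}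
  {a : ∀ l, Fin (n l) → Ω → X} {θ : ∀ l, Fin (m l) → Ω → T}

/-- The asymptotic oracle inequality. The constant `C₀` in front of the approximation error does not
depend on the coefficient function `h`, so that `h` may be optimized afterwards. -/
lemma exists_ae_eventually_popRisk_le (hB : 0 < B)
    (hφ : StronglyMeasurable (Function.uncurry φ)) (hφB : ∀ x t, ‖φ x t‖ ≤ B)
    (hF : StronglyMeasurable F) (hFB : ∀ x, ‖F x‖ ≤ B)
    (hδ : ∀ l, δ l ∈ Set.Ioo (0 : ℝ) 1) (hδsum : Summable δ)
    (hm : TwoSidedBound (fun l => (m l : ℝ)) (fun l => (δ l)⁻¹ * Real.log (2 / δ l)))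
    (hn : TwoSidedBound (fun l => (n l : ℝ)) (fun l => ((δ l) ^ 2)⁻¹ * Real.log (2 / δ l)))
    (hreg : TwoSidedBound reg (fun l => (m l : ℝ)))
    (hlaw : ∀ l, HasLaw (fun ω => ((fun i => a l i ω), (fun j => θ l j ω)))
      ((Measure.pi fun _ : Fin (n l) => ν).prod (Measure.pi fun _ : Fin (m l) => μ)) P) :
    ∃ C₀ : ℝ, 0 < C₀ ∧ ∀ (h : T → ℝ) (M : ℝ), StronglyMeasurable h → (∀ t, |h t| ≤ M) →
      ∃ K : ℝ, ∀ᵐ ω ∂P, ∀ᶠ l in atTop, ∀ α : EuclideanSpace ℝ (Fin (m l)),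
        IsTrained φ (fun j => θ l j ω) (fun i => a l i ω) (fun i => F (a l i ω)) (reg l) α →
        popRisk ν φ F (fun j => θ l j ω) α
          ≤ C₀ * (2 * ∫ x, ‖F x - featureAverage φ μ h x‖ ^ 2 ∂ν + K * δ l) := by
  obtain ⟨hpos, c, C, hc, hC, hrates⟩ := exists_rates hδ hm hn hreg
  -- `K₁`, and `K₂`, `K₃` below, are chosen so that each of the three deviations is at most `Kᵢ δ`
  -- up to probability `δ`; `κ` compares the gap `K₁ δ` with the regularization `reg / n ≥ c δ`
  set K₁ : ℝ := 4 * (2 * B ^ 2) / √c with hK₁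
  have hK₁0 : 0 < K₁ := by positivity
  set κ : ℝ := K₁ / c with hκ
  have hκ0 : 0 < κ := by positivity
  refine ⟨1 + κ, by positivity, fun h M₀ hh hM₀ => ?_⟩
  set M : ℝ := max M₀ 1
  have hM0 : 0 < M := lt_max_of_lt_right one_pos
  have hM : ∀ t, |h t| ≤ M := fun t => (hM₀ t).trans (le_max_left _ _)
  set G : X → Y := featureAverage φ μ h
  have hGm : StronglyMeasurable G := stronglyMeasurable_featureAverage hφ hh
  set B' : ℝ := B + M * B
  have hB'0 : 0 < B' := by positivity
  have hFG : ∀ x, ‖F x - G x‖ ≤ B' := fun x =>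
    (norm_sub_le _ _).trans (add_le_add (hFB x) (norm_featureAverage_le hφB hM x))
  set K₂ : ℝ := 4 * B' ^ 2 / √c
  set K₃ : ℝ := 16 * (M * B) ^ 2 / c with hK₃
  have hsq : ∀ (S : ℝ) (l : ℕ),
      16 * S ^ 2 * Real.log (2 / δ l) ≤ n l * (4 * S / √c * δ l) ^ 2 := by
    intro S l
    have e : (n l : ℝ) * (4 * S / √c * δ l) ^ 2 = 16 * S ^ 2 / c * (n l * δ l ^ 2) := by
      rw [mul_pow, div_pow, Real.sq_sqrt hc.le]; ring
    calc 16 * S ^ 2 * Real.log (2 / δ l) = 16 * S ^ 2 / c * (c * Real.log (2 / δ l)) := by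
          field_simp
      _ ≤ _ := by rw [e]; exact mul_le_mul_of_nonneg_left (hrates l).1 (by positivity)
  have hδ0 : ∀ l, 0 ≤ δ l := fun l => (hδ l).1.le
  have ev₁ := ae_eventually_notMem_of_summable (P := P) hδ0 hδsum fun l =>
    measure_gram_deviation_le hB hφ hφB hF hFB (hpos l).2.1 (hlaw l)
      (t := K₁ * δ l) (mul_nonneg hK₁0.le (hδ0 l)) (hδ l).1 (hsq (2 * B ^ 2) l)
  have ev₂ := ae_eventually_notMem_of_summable (P := P) hδ0 hδsum fun l =>
    measure_empirical_norm_sq_deviation_le (hF.sub hGm) hB'0 hFG (hpos l).2.1 (hlaw l)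
      (t := K₂ * δ l) (mul_nonneg (by positivity) (hδ0 l)) (hδ l).1 (hsq (B' ^ 2) l)
  have ev₃ := ae_eventually_notMem_of_summable (P := P) hδ0 hδsum fun l =>
    measure_oracle_deviation_le hB hφ hφB hh hM0 hM (hpos l).1 (hpos l).2.1 (hlaw l)
      (t := K₃ * δ l) (mul_nonneg (by positivity) (hδ0 l)) (hδ l).1 (by
        calc 16 * (M * B) ^ 2 * Real.log (2 / δ l) = K₃ * (c * Real.log (2 / δ l)) := by
              rw [hK₃]; field_simp
          _ ≤ K₃ * (m l * δ l) :=
              mul_le_mul_of_nonneg_left (hrates l).2.1 (by positivity)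
          _ = _ := by ring)
  refine ⟨2 * K₂ + 2 * K₃ + C * M ^ 2 + K₁, ?_⟩
  filter_upwards [ev₁, ev₂, ev₃] with ω h₁ h₂ h₃
  filter_upwards [h₁, h₂, h₃] with l h₁ h₂ h₃ α hα
  simp only [not_le] at h₁ h₂ h₃
  obtain ⟨-, -, hr1, hr2⟩ := hrates l
  have hd := hδ0 l
  have hgap := popRisk_le_empRisk_add (integrable_gram_augFeature hφ hφB hF hFB _) h₁.le α
  have hor := hα.popRisk_le (ν := ν) (hpos l).2.1 (hpos l).2.2 hκ0.le
    (by
      calc K₁ * δ l = κ * (c * δ l) := by rw [hκ]; field_simp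
        _ ≤ _ := mul_le_mul_of_nonneg_left hr1 hκ0.le) hgap (oracleCoeff h fun j => θ l j ω)
  have hemp := empRisk_le φ F G (fun j => θ l j ω) (fun i => a l i ω)
    (oracleCoeff h fun j => θ l j ω)
  have h₂' := (le_abs_self _).trans h₂.le
  simp only [smul_eq_mul, Pi.sub_apply] at h₂'
  have hreg' : reg l / n l * (‖oracleCoeff h fun j => θ l j ω‖ ^ 2 / m l) ≤ C * δ l * M ^ 2 :=
    mul_le_mul hr2 (norm_oracleCoeff_sq_div_le hM _) (by positivity) (by positivity)
  have hfin : empRisk φ F (fun j => θ l j ω) (fun i => a l i ω) (oracleCoeff h fun j => θ l j ω)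
      + reg l / n l * (‖oracleCoeff h fun j => θ l j ω‖ ^ 2 / m l)
      ≤ 2 * ∫ x, ‖F x - G x‖ ^ 2 ∂ν + (2 * K₂ + 2 * K₃ + C * M ^ 2) * δ l := by
    linarith
  have hfin2 := mul_le_mul_of_nonneg_left hfin (show 0 ≤ 1 + κ by positivity)
  have hk : 0 ≤ κ * (K₁ * δ l) := by positivity
  linarith

/-- Almost sure convergence of the population risk for bounded measurable features. -/
lemma ae_tendsto_popRisk (hB : 0 < B)
    (hφ : StronglyMeasurable (Function.uncurry φ)) (hφB : ∀ x t, ‖φ x t‖ ≤ B)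
    (hF : StronglyMeasurable F) (hFB : ∀ x, ‖F x‖ ≤ B)
    (hinj : KernelIntegralInjective (featureKernel φ μ) ν)
    (hδ : ∀ l, δ l ∈ Set.Ioo (0 : ℝ) 1) (hδsum : Summable δ)
    (hm : TwoSidedBound (fun l => (m l : ℝ)) (fun l => (δ l)⁻¹ * Real.log (2 / δ l)))
    (hn : TwoSidedBound (fun l => (n l : ℝ)) (fun l => ((δ l) ^ 2)⁻¹ * Real.log (2 / δ l)))
    (hreg : TwoSidedBound reg (fun l => (m l : ℝ)))
    (hlaw : ∀ l, HasLaw (fun ω => ((fun i => a l i ω), (fun j => θ l j ω)))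
      ((Measure.pi fun _ : Fin (n l) => ν).prod (Measure.pi fun _ : Fin (m l) => μ)) P) :
    ∀ᵐ ω ∂P, ∀ α : ∀ l, EuclideanSpace ℝ (Fin (m l)),
      (∀ l, IsTrained φ (fun j => θ l j ω) (fun i => a l i ω) (fun i => F (a l i ω)) (reg l)
        (α l)) →
      Tendsto (fun l => popRisk ν φ F (fun j => θ l j ω) (α l)) atTop (𝓝 0) := by
  obtain ⟨C₀, hC₀, key⟩ := exists_ae_eventually_popRisk_le (ν := ν) (μ := μ) (P := P) hB hφ hφB hF
    hFB hδ hδsum hm hn hreg hlaw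
  have hF2 : MemLp F 2 ν := .of_bound hF.aestronglyMeasurable B (.of_forall hFB)
  have happrox : ∀ k : ℕ, ∀ᵐ ω ∂P, ∀ᶠ l in atTop, ∀ α : EuclideanSpace ℝ (Fin (m l)),
      IsTrained φ (fun j => θ l j ω) (fun i => a l i ω) (fun i => F (a l i ω)) (reg l) α →
      popRisk ν φ F (fun j => θ l j ω) α ≤ C₀ * (3 * (1 / ((k : ℝ) + 1))) := by
    intro k
    have hk : (0 : ℝ) < 1 / ((k : ℝ) + 1) := by positivity
    obtain ⟨h, M, hh, hM, hlt⟩ :=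
      exists_integral_norm_sub_featureAverage_sq_lt hφ hφB hinj hF2 hk
    obtain ⟨K, hK⟩ := key h M hh hM
    have hsmall : ∀ᶠ l in atTop, K * δ l < 1 / ((k : ℝ) + 1) := by
      have : Tendsto (fun l => K * δ l) atTop (𝓝 (K * 0)) :=
        hδsum.tendsto_atTop_zero.const_mul K
      rw [mul_zero] at this
      exact this.eventually_lt_const hk
    filter_upwards [hK] with ω hω
    filter_upwards [hω, hsmall] with l hl hs α hα
    exact (hl α hα).trans (mul_le_mul_of_nonneg_left (by linarith) hC₀.le)
  filter_upwards [ae_all_iff.mpr happrox] with ω hω α hα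
  have hnonneg : ∀ l, 0 ≤ popRisk ν φ F (fun j => θ l j ω) (α l) := fun l =>
    integral_nonneg fun x => by positivity
  have hlim : Tendsto (fun k : ℕ => C₀ * (3 * (1 / ((k : ℝ) + 1)))) atTop (𝓝 0) := by
    simpa using (tendsto_one_div_add_atTop_nhds_zero_nat.const_mul (3 : ℝ)).const_mul C₀
  refine tendsto_order.mpr ⟨fun b hb => .of_forall fun l => hb.trans_le (hnonneg l), fun b hb => ?_⟩
  obtain ⟨k, hk⟩ := (hlim.eventually_lt_const hb).exists
  filter_upwards [hω k] with l hl
  exact (hl (α l) (hα l)).trans_lt hk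

end Consistency

/-! ### Essentially bounded features -/

section Modification

/-- An essentially bounded function has a measurable modification that is bounded everywhere. -/
lemma exists_bounded_modification {Z G : Type*} [MeasurableSpace Z] {ρ : Measure Z}
    [NormedAddCommGroup G] {f : Z → G} (hf : MemLp f ⊤ ρ) :
    ∃ (g : Z → G) (B : ℝ), StronglyMeasurable g ∧ (∀ z, ‖g z‖ ≤ B) ∧ f =ᵐ[ρ] g := by
  set B : ℝ := (eLpNorm f ⊤ ρ).toReal
  set g₀ : Z → G := hf.1.mk f
  have hg₀m : StronglyMeasurable g₀ := hf.1.stronglyMeasurable_mk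
  have hset : MeasurableSet {z | ‖g₀ z‖ ≤ B} :=
    measurableSet_le hg₀m.norm.measurable measurable_const
  refine ⟨{z | ‖g₀ z‖ ≤ B}.indicator g₀, B, hg₀m.indicator hset, fun z => ?_, ?_⟩
  · by_cases hz : ‖g₀ z‖ ≤ B
    · rwa [Set.indicator_of_mem (show z ∈ {z | ‖g₀ z‖ ≤ B} from hz)]
    · rw [Set.indicator_of_notMem (show z ∉ {z | ‖g₀ z‖ ≤ B} from hz), norm_zero]
      exact ENNReal.toReal_nonneg
  · have hbound : ∀ᵐ z ∂ρ, ‖f z‖ ≤ B := by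
      filter_upwards [ae_le_eLpNormEssSup (f := f) (μ := ρ)] with z hz
      rw [← eLpNorm_exponent_top] at hz
      rw [← toReal_enorm]
      exact ENNReal.toReal_mono hf.eLpNorm_ne_top hz
    filter_upwards [hbound, hf.1.ae_eq_mk] with z hz hzg
    rw [Set.indicator_of_mem (show z ∈ {z | ‖g₀ z‖ ≤ B} from by
      change ‖hf.1.mk f z‖ ≤ B; rwa [← hzg])]
    exact hzg

variable {X T Y : Type*} [MeasurableSpace X] [MeasurableSpace T]
  [NormedAddCommGroup Y] [InnerProductSpace ℝ Y]
  {ν : Measure X} {μ : Measure T} [IsProbabilityMeasure μ] {φ ψ : X → T → Y}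

lemma kernelIntegral_featureKernel_ae_eq
    (h : Function.uncurry φ =ᵐ[ν.prod μ] Function.uncurry ψ) (g : X → Y) :
    kernelIntegral (featureKernel φ μ) ν g =ᵐ[ν] kernelIntegral (featureKernel ψ μ) ν g := by
  have h1 : ∀ᵐ x ∂ν, ∀ᵐ t ∂μ, φ x t = ψ x t := Measure.ae_ae_of_ae_prod h
  filter_upwards [h1] with x hx
  refine integral_congr_ae ?_
  filter_upwards [h1] with x' hx'
  have : featureKernel φ μ x x' = featureKernel ψ μ x x' := by
    refine integral_congr_ae ?_
    filter_upwards [hx, hx'] with t ht ht'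
    rw [ht, ht']
  rw [this]

lemma KernelIntegralInjective.congr (hinj : KernelIntegralInjective (featureKernel φ μ) ν)
    (h : Function.uncurry φ =ᵐ[ν.prod μ] Function.uncurry ψ) :
    KernelIntegralInjective (featureKernel ψ μ) ν := fun f g hfg =>
  hinj f g ((kernelIntegral_featureKernel_ae_eq h f).trans
    (hfg.trans (kernelIntegral_featureKernel_ae_eq h g).symm))

/-- Almost surely, modifying the target and the features on null sets changes neither the training
data nor the classes of the features in `L²_ν(X; Y)`. -/
lemma ae_sample_eq {X T Y Ω : Type*} [MeasurableSpace X] [MeasurableSpace T] [MeasurableSpace Ω]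
    {ν : Measure X} [IsProbabilityMeasure ν] {μ : Measure T} [IsProbabilityMeasure μ]
    {P : Measure Ω} {m n : ℕ} {a : Fin n → Ω → X} {θ : Fin m → Ω → T} {φ ψ : X → T → Y}
    {F G : X → Y}
    (hlaw : HasLaw (fun ω => ((fun i => a i ω), (fun j => θ j ω)))
      ((Measure.pi fun _ : Fin n => ν).prod (Measure.pi fun _ : Fin m => μ)) P)
    (hFG : F =ᵐ[ν] G) (h : Function.uncurry φ =ᵐ[ν.prod μ] Function.uncurry ψ) :
    ∀ᵐ ω ∂P, (∀ i, F (a i ω) = G (a i ω)) ∧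
      (∀ i j, φ (a i ω) (θ j ω) = ψ (a i ω) (θ j ω)) ∧
      ∀ j, ∀ᵐ x ∂ν, φ x (θ j ω) = ψ x (θ j ω) := by
  have hswap : ∀ᵐ t ∂μ, ∀ᵐ x ∂ν, φ x t = ψ x t := by
    have h1 : ∀ᵐ p ∂(μ.prod ν), φ p.2 p.1 = ψ p.2 p.1 :=
      (Measure.measurePreserving_swap (μ := μ) (ν := ν)).quasiMeasurePreserving.ae h
    exact Measure.ae_ae_of_ae_prod h1
  have hA : ∀ᵐ p ∂((Measure.pi fun _ : Fin n => ν).prod (Measure.pi fun _ : Fin m => μ)),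
      (∀ i, F (p.1 i) = G (p.1 i)) ∧ (∀ i j, φ (p.1 i) (p.2 j) = ψ (p.1 i) (p.2 j)) ∧
      ∀ j, ∀ᵐ x ∂ν, φ x (p.2 j) = ψ x (p.2 j) := by
    refine Eventually.and ?_ (Eventually.and ?_ ?_)
    · refine ae_all_iff.mpr fun i => ?_
      exact ((measurePreserving_eval (fun _ : Fin n => ν) i).comp
        measurePreserving_fst).quasiMeasurePreserving.ae hFG
    · refine ae_all_iff.mpr fun i => ae_all_iff.mpr fun j => ?_
      exact ((measurePreserving_eval (fun _ : Fin n => ν) i).prod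
        (measurePreserving_eval (fun _ : Fin m => μ) j)).quasiMeasurePreserving.ae h
    · refine ae_all_iff.mpr fun j => ?_
      exact ((measurePreserving_eval (fun _ : Fin m => μ) j).comp
        measurePreserving_snd).quasiMeasurePreserving.ae hswap
  rw [← hlaw.map_eq] at hA
  exact ae_of_ae_map hlaw.aemeasurable hA

end Modification

end RandomFeatures

theorem mainTheorem5
    -- input space, feature parameter space, output space
    {X T Y : Type*}
    [NormedAddCommGroup X] [NormedSpace ℝ X] [CompleteSpace X] [MeasurableSpace X] [BorelSpace X]
    [NormedAddCommGroup T] [NormedSpace ℝ T] [CompleteSpace T] [MeasurableSpace T] [BorelSpace T]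
    [NormedAddCommGroup Y] [InnerProductSpace ℝ Y] [CompleteSpace Y]
    [TopologicalSpace.SeparableSpace Y]
    (ν : Measure X) [IsProbabilityMeasure ν] (μ : Measure T) [IsProbabilityMeasure μ]
    -- the ground truth is essentially bounded
    (Fd : X → Y) (hFd : MemLp Fd ⊤ ν)
    -- the random feature map is measurable and bounded
    (φ : X → T → Y) (hφ : MemLp (Function.uncurry φ) ⊤ (ν.prod μ))
    -- the RKHS of the random feature pair is separable
    {H : Type*} [NormedAddCommGroup H] [InnerProductSpace ℝ H] [CompleteSpace H] [RKHS ℝ H X Y]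
    (hH : RandomFeatures.IsFeatureRKHS φ μ H) (hsep : TopologicalSpace.SeparableSpace H)
    -- the integral operator of the kernel is injective
    (hinj : RandomFeatures.KernelIntegralInjective (RandomFeatures.featureKernel φ μ) ν)
    -- the sequences that link the parameters
    (δ : ℕ → ℝ) (hδ : ∀ l, δ l ∈ Set.Ioo (0 : ℝ) 1) (hδsum : Summable δ)
    (m n : ℕ → ℕ) (reg : ℕ → ℝ)
    (hm : RandomFeatures.TwoSidedBound (fun l => (m l : ℝ))
      (fun l => (δ l)⁻¹ * Real.log (2 / δ l)))
    (hn : RandomFeatures.TwoSidedBound (fun l => (n l : ℝ))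
      (fun l => ((δ l) ^ 2)⁻¹ * Real.log (2 / δ l)))
    (hreg : RandomFeatures.TwoSidedBound reg (fun l => (m l : ℝ)))
    -- for each `l`, i.i.d. inputs and, independently, i.i.d. feature parameters
    -- (with any dependence between different `l`)
    {Ω : Type*} [MeasurableSpace Ω] (P : Measure Ω) [IsProbabilityMeasure P]
    (a : ∀ l, Fin (n l) → Ω → X) (θ : ∀ l, Fin (m l) → Ω → T)
    (hlaw : ∀ l, HasLaw (fun ω => ((fun i => a l i ω), (fun j => θ l j ω)))
      ((Measure.pi fun _ : Fin (n l) => ν).prod (Measure.pi fun _ : Fin (m l) => μ)) P)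
    -- the coefficients trained on the noise-free data `y_i = Fd (a_i)`
    (α : ∀ l, Ω → EuclideanSpace ℝ (Fin (m l)))
    (hα : ∀ l ω, RandomFeatures.IsTrained φ (fun j => θ l j ω) (fun i => a l i ω)
      (fun i => Fd (a l i ω)) (reg l) (α l ω)) :
    ∀ᵐ ω ∂P,
      (∀ l, MemLp (fun x => Fd x - RandomFeatures.rfm φ (fun j => θ l j ω) (α l ω) x) 2 ν) ∧
      Tendsto
        (fun l => ∫ x, ‖Fd x - RandomFeatures.rfm φ (fun j => θ l j ω) (α l ω) x‖ ^ 2 ∂ν)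
        atTop (𝓝 0) := by
  obtain ⟨ψ, B₁, hψ, hψB, hφψ⟩ := RandomFeatures.exists_bounded_modification hφ
  obtain ⟨G, B₂, hG, hGB, hFG⟩ := RandomFeatures.exists_bounded_modification hFd
  have hcons := RandomFeatures.ae_tendsto_popRisk (ν := ν) (μ := μ) (P := P)
    (φ := fun x t => ψ (x, t)) (F := G) (B := max (max B₁ B₂) 1) (lt_max_of_lt_right one_pos) hψ
    (fun x t => (hψB (x, t)).trans ((le_max_left _ _).trans (le_max_left _ _))) hG
    (fun x => (hGB x).trans ((le_max_right _ _).trans (le_max_left _ _)))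
    (hinj.congr hφψ) hδ hδsum hm hn hreg hlaw
  have hsample := ae_all_iff.mpr fun l =>
    RandomFeatures.ae_sample_eq (ψ := fun x t => ψ (x, t)) (hlaw l) hFG hφψ
  filter_upwards [hcons, hsample] with ω hω hs
  constructor
  · intro l
    have hfeat : ∀ j, MemLp (fun x => φ x (θ l j ω)) 2 ν := fun j =>
      MemLp.ae_eq (EventuallyEq.symm ((hs l).2.2 j))
        (.of_bound (hψ.comp_measurable measurable_prodMk_right).aestronglyMeasurable B₁
          (.of_forall fun x => hψB (x, θ l j ω)))
    exact (hFd.mono_exponent le_top).sub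
      ((memLp_finsetSum Finset.univ fun j _ => (hfeat j).const_smul (α l ω j)).const_smul
        (1 / (m l : ℝ)))
  · have htrained : ∀ l, RandomFeatures.IsTrained (fun x t => ψ (x, t)) (fun j => θ l j ω)
        (fun i => a l i ω) (fun i => G (a l i ω)) (reg l) (α l ω) := by
      intro l
      have hobj : RandomFeatures.ridgeObjective (fun x t => ψ (x, t)) (fun j => θ l j ω)
          (fun i => a l i ω) (fun i => G (a l i ω)) (reg l)
          = RandomFeatures.ridgeObjective φ (fun j => θ l j ω) (fun i => a l i ω)
            (fun i => Fd (a l i ω)) (reg l) := by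
        funext β
        simp only [RandomFeatures.ridgeObjective, RandomFeatures.rfm, (hs l).1, (hs l).2.1]
      rw [RandomFeatures.IsTrained, hobj]
      exact hα l ω
    refine (hω (fun l => α l ω) htrained).congr fun l => integral_congr_ae ?_
    filter_upwards [hFG, ae_all_iff.mpr (hs l).2.2] with x hx hxj
    simp only [RandomFeatures.rfm, hx, hxj]
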